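/- For an integer $k\ge 2$ and $p,q,s\in(0,1)$, let $\mathsf{SignedBlock}_k(p,q,s)$ be the following random signed graph on the nodes $\{1,\dots,2k\}$, split into the two communities $\{1,\dots,k\}$ and $\{k+1,\dots,2k\}$. Each pair of distinct nodes becomes an edge with probability $p$ if both nodes lie in the same community, and with probability $q$ otherwise; it receives a negative sign with probability $s$ if both nodes lie in the same community, and with probability $1-s$ otherwise (and a positive sign if not); all these choices are mutually independent. Write $A\sim\mathsf{SignedBlock}_k(p,q,s)$ for its signed adjacency matrix, i.e. the symmetric $2k\times 2k$ matrix whose $(i,j)$ entry is the sign $\pm1$ of the edge $\{i,j\}$ if it is present, and $0$ otherwise. Let $D$ be the diagonal matrix of node degrees $d_i=\sum_j|a_{ij}|$, and let $\mathcal L=D^{-1/2}(D-A)D^{-1/2}$ be the normalized signed Laplacian matrix, where $(D^{-1/2})_{ii}=0$ if $d_i=0$. Denote its eigenvalues, with multiplicity, by $\lambda_1(\mathcal L)\le\lambda_2(\mathcal L)\le\dots\le\lambda_{2k}(\mathcal L)$. Corollary 4.5. Fix $\gamma_1>\gamma_2>0$ and $0<s<1/2$. There exist a constant $C>0$ and an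 integer $K$, depending only on $\gamma_1,\gamma_2,s$, such that for every integer $k\ge \max(2,K)$ for which $\gamma_1k^{-1/2}$ and $\gamma_2k^{-1/2}$ are probabilities (which holds for all large $k$) and every $A\sim\mathsf{SignedBlock}_k(\gamma_1k^{-1/2},\gamma_2k^{-1/2},s)$, with probability at least $1-k^{-2}$ all of the following estimates hold: $$|\lambda_1(\mathcal L)-2s|\le Ck^{-1/4},$$ $$\left|\lambda_2(\mathcal L)-\left(1-(1-2s)\frac{\gamma_1-\gamma_2}{\gamma_1+\gamma_2}\right)\right|\le Ck^{-1/4},$$ $$|\lambda_\ell(\mathcal L)-1|\le Ck^{-1/4}\quad\text{for all } 2<\ell\le 2k.$$ -/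

import Mathlib

open MeasureTheory ProbabilityTheory

/-- The Borel (product) σ-algebra on real `n × n` matrices. -/
instance matrixMeasurableSpace (n : ℕ) : MeasurableSpace (Matrix (Fin n) (Fin n) ℝ) :=
  inferInstanceAs (MeasurableSpace (Fin n → Fin n → ℝ))

/-- The unordered pairs of distinct nodes of `[n]`, each listed once, smaller node first. -/
abbrev NodePair (n : ℕ) : Type := {e : Fin n × Fin n // e.1 < e.2}

/-- Outcome of the sampling at one pair of nodes: the first component says whether the edge is
present, the second one whether the drawn sign is negative. The value is the corresponding entry
of the signed adjacency matrix. -/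
def signedEntry (b : Bool × Bool) : ℝ :=
  if b.1 then (if b.2 then -1 else 1) else 0

/-- The signed adjacency matrix (symmetric, with zero diagonal) of a sampled signed graph. -/
def signedAdjacency {n : ℕ} (x : NodePair n → Bool × Bool) : Matrix (Fin n) (Fin n) ℝ :=
  Matrix.of fun i j =>
    if h : i < j then signedEntry (x ⟨(i, j), h⟩)
    else if h : j < i then signedEntry (x ⟨(j, i), h⟩)
    else 0

/-- The signed inhomogeneous Erdős–Rényi model `G_n(P, S)`, as the law of the signed adjacency
matrix on the space of matrices: every pair `{i, j}` becomes an edge with probability `P i j` and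
gets a negative sign with probability `S i j`, all these choices being mutually independent.
`P` and `S` are symmetric matrices of probabilities (only the entries with `i < j` are read). -/
noncomputable def signedErdosRenyi {n : ℕ} (P S : Matrix (Fin n) (Fin n) unitInterval) :
    Measure (Matrix (Fin n) (Fin n) ℝ) :=
  (Measure.pi fun e : NodePair n =>
    (bernoulliMeasure true false (P e.1.1 e.1.2)).prod
      (bernoulliMeasure true false (S e.1.1 e.1.2))).map signedAdjacency

/-- Extension of a matrix of block probabilities to a matrix indexed by the nodes, where
`c i` is the block of node `i`; the diagonal is zero. -/
def blockExtend {n m : ℕ} (c : Fin n → Fin m) (M : Matrix (Fin m) (Fin m) unitInterval) :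
    Matrix (Fin n) (Fin n) unitInterval :=
  Matrix.of fun i j => if i = j then 0 else M (c i) (c j)

/-- The even bipartition of `[2k]`: the first `k` nodes and the last `k` nodes. -/
def bisection (k : ℕ) (i : Fin (2 * k)) : Fin 2 := if i.val < k then 0 else 1

/-- The signed stochastic bisection model `SignedBlock_k(p, q, s)`, as a law on matrices. -/
noncomputable def signedBlock (k : ℕ) (p q s : unitInterval) :
    Measure (Matrix (Fin (2 * k)) (Fin (2 * k)) ℝ) :=
  signedErdosRenyi
    (blockExtend (bisection k) !![p, q; q, p])
    (blockExtend (bisection k) !![s, unitInterval.symm s; unitInterval.symm s, s])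

/-- The degree of node `i` in the graph with signed adjacency matrix `A`: the number of edges
incident to `i`, that is, the `i`-th row sum of `|A|`. -/
def nodeDegree {n : ℕ} (A : Matrix (Fin n) (Fin n) ℝ) (i : Fin n) : ℝ := ∑ j, |A i j|

/-- The signed Laplacian matrix `L = D - A`. -/
def signedLaplacian {n : ℕ} (A : Matrix (Fin n) (Fin n) ℝ) : Matrix (Fin n) (Fin n) ℝ :=
  Matrix.diagonal (nodeDegree A) - A

/-- The matrix `D^{-1/2}`, with diagonal entry `0` at nodes of degree `0`. -/
noncomputable def invSqrtDegree {n : ℕ} (A : Matrix (Fin n) (Fin n) ℝ) :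
    Matrix (Fin n) (Fin n) ℝ :=
  Matrix.diagonal fun i => (√(nodeDegree A i))⁻¹

/-- The normalized signed Laplacian matrix `D^{-1/2} L D^{-1/2}`. -/
noncomputable def normalizedSignedLaplacian {n : ℕ} (A : Matrix (Fin n) (Fin n) ℝ) :
    Matrix (Fin n) (Fin n) ℝ :=
  invSqrtDegree A * signedLaplacian A * invSqrtDegree A

open Classical in
/-- `eigval X l` is the `l`-th eigenvalue `λ_l(X)`, `1 ≤ l ≤ n`, of a real symmetric matrix `X`,
the eigenvalues being listed with multiplicity in ascending order `λ_1(X) ≤ … ≤ λ_n(X)`.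
(`Matrix.IsHermitian.eigenvalues₀` is the same list in descending order, indexed from `0`.)
For a matrix that is not symmetric, or an index out of range, the value is `0`. -/
noncomputable def eigval {n : ℕ} (X : Matrix (Fin n) (Fin n) ℝ) (l : ℕ) : ℝ :=
  if h : X.IsHermitian ∧ 1 ≤ l ∧ l ≤ n then
    h.1.eigenvalues₀ ⟨n - l, by rw [Fintype.card_fin]; omega⟩
  else 0

/-! Put R² = k(p+q), of order k^(1/2), and let v be the vector which is ±1 on the two communities.
Up to a multiple of the identity of size at most 1, the mean of A is (1-2s)((p-q)/2 · 11ᵀ + (p+q)/2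
· vvᵀ), and all expected degrees equal R² - p. Hence the normalized Laplacian should be close to the
identity minus a rank two matrix with eigenvalue 1-2s on v and (1-2s)(γ₁-γ₂)/(γ₁+γ₂) on 1. An error
688/R in the quadratic form passes to every eigenvalue by the min-max principle
(`eigval_of_quadratic_form_approx`), and 1/R is of order k^(-1/4).

For the quadratic form (`abs_quadratic_form_sub_le`), it suffices that A and |A| are within O(R) of
their means in spectral norm and that all degrees are at least R²/8. The bound for |A|, applied to
the vector 1, controls the sum of the (dᵢ - R²)²; by Cauchy–Schwarz this suffices to replace D by R²
in the two rank one terms. The lower bound on the degrees comes from an exponential moment.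

The norm bounds come from the trace method, with an exponent L of order log k. The expected trace is
a sum over walks; a walk with an edge traversed exactly once contributes 0, and any other at most c
to the number of its distinct edges, where c bounds the variances. Walks are not classified by
shape: a potential on the states of a growing walk (`stateWeight`) is chosen so that one step
multiplies the total weight by at most 3r, where r² = cn (`stateWeight_step_le`,
`sum_stepWeight_le`). This needs (L+1)² ≤ r, which holds eventually because r is of order k^(1/4).
-/

/-! ### Weighted counting of walks by a potential. -/

section Walks

variable {V : Type*}

/-- The edges traversed by a walk, given as the list of its vertices, most recent first. -/
def walkEdges : List V → List (Sym2 V)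
  | [] => []
  | [_] => []
  | v :: u :: h => s(u, v) :: walkEdges (u :: h)

theorem mem_of_mem_walkEdges {h : List V} {e : Sym2 V} (he : e ∈ walkEdges h) {x : V}
    (hx : x ∈ e) : x ∈ h := by
  induction h with
  | nil => simp [walkEdges] at he
  | cons v h ih =>
    cases h with
    | nil => simp [walkEdges] at he
    | cons u h =>
      rw [walkEdges, List.mem_cons] at he
      rcases he with rfl | he
      · rcases Sym2.mem_iff.1 hx with rfl | rfl <;> simp
      · exact List.mem_cons_of_mem _ (ih he)

variable [DecidableEq V]

/-- The edges of a walk which led to a new vertex and have not been traversed since. -/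
def pendingEdges : List V → Finset (Sym2 V)
  | [] => ∅
  | [_] => ∅
  | v :: u :: h =>
    if v ∈ u :: h then (pendingEdges (u :: h)).erase s(u, v)
    else insert s(u, v) (pendingEdges (u :: h))

/-- The number of steps of a walk which led to a new vertex. -/
def newVertexSteps : List V → ℕ
  | [] => 0
  | [_] => 0
  | v :: u :: h => newVertexSteps (u :: h) + if v ∈ u :: h then 0 else 1

/-- When inserted, the edge reaches an unvisited vertex, so it was not traversed before. Any later
traversal ends at a visited vertex and erases it. -/
theorem count_walkEdges_of_mem_pendingEdges {h : List V} {e : Sym2 V}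
    (he : e ∈ pendingEdges h) : (walkEdges h).count e = 1 := by
  induction h with
  | nil => simp [pendingEdges] at he
  | cons v h ih =>
    cases h with
    | nil => simp [pendingEdges] at he
    | cons u h =>
      rw [pendingEdges] at he
      rw [walkEdges]
      split_ifs at he with hv
      · rw [Finset.mem_erase] at he
        rw [List.count_cons_of_ne (Ne.symm he.1), ih he.2]
      · rw [Finset.mem_insert] at he
        rcases he with rfl | he
        · rw [List.count_cons_self, List.count_eq_zero_of_not_mem]
          exact fun hm => hv (mem_of_mem_walkEdges hm (Sym2.mem_mk_right u v))
        · rw [List.count_cons_of_ne, ih he]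
          rintro rfl
          have hm : s(u, v) ∈ walkEdges (u :: h) :=
            List.count_pos_iff.1 (by rw [ih he]; exact one_pos)
          exact hv (mem_of_mem_walkEdges hm (Sym2.mem_mk_right u v))

theorem mem_of_mem_pendingEdges {h : List V} {e : Sym2 V} (he : e ∈ pendingEdges h) {x : V}
    (hx : x ∈ e) : x ∈ h := by
  refine mem_of_mem_walkEdges (List.count_pos_iff.1 ?_) hx
  rw [count_walkEdges_of_mem_pendingEdges he]
  exact one_pos

/-- A step to a new vertex uses an edge containing that vertex, hence an edge not used before. -/
theorem newVertexSteps_le_card (h : List V) :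
    newVertexSteps h ≤ (walkEdges h).toFinset.card := by
  induction h with
  | nil => simp [newVertexSteps]
  | cons v h ih =>
    cases h with
    | nil => simp [newVertexSteps]
    | cons u h =>
      rw [newVertexSteps, walkEdges, List.toFinset_cons]
      split_ifs with hv
      · exact ih.trans (Finset.card_le_card (Finset.subset_insert _ _))
      · rw [Finset.card_insert_of_notMem]
        · omega
        · rw [List.mem_toFinset]
          exact fun hm => hv (mem_of_mem_walkEdges hm (Sym2.mem_mk_right u v))

theorem not_isDiag_of_mem_pendingEdges {h : List V} {e : Sym2 V} (he : e ∈ pendingEdges h) :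
    ¬ e.IsDiag := by
  induction h with
  | nil => simp [pendingEdges] at he
  | cons v h ih =>
    cases h with
    | nil => simp [pendingEdges] at he
    | cons u h =>
      rw [pendingEdges] at he
      split_ifs at he with hv
      · exact ih (Finset.mem_of_mem_erase he)
      · rw [Finset.mem_insert] at he
        rcases he with rfl | he
        · rw [Sym2.mk_isDiag_iff]
          rintro rfl
          simp at hv
        · exact ih he

/-- The number of edges of `P` incident to `w`. -/
def incidenceDegree (P : Finset (Sym2 V)) (w : V) : ℕ := (P.filter fun e => w ∈ e).card

theorem incidenceDegree_insert {P : Finset (Sym2 V)} {e : Sym2 V} (he : e ∉ P) (w : V) :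
    incidenceDegree (insert e P) w = incidenceDegree P w + if w ∈ e then 1 else 0 := by
  unfold incidenceDegree
  rw [Finset.filter_insert]
  split_ifs with hw
  · rw [Finset.card_insert_of_notMem (by simp [he])]
  · simp

theorem incidenceDegree_erase {P : Finset (Sym2 V)} {e : Sym2 V} (he : e ∈ P) (w : V) :
    incidenceDegree P w = incidenceDegree (P.erase e) w + if w ∈ e then 1 else 0 := by
  rw [← incidenceDegree_insert (Finset.notMem_erase e P), Finset.insert_erase he]

variable [Fintype V]

/-- A potential measuring how far the edge set `P` is from a path which ends at `u`. -/
def pathDefect (P : Finset (Sym2 V)) (u : V) : ℕ :=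
  ∑ w, (incidenceDegree P w - if w = u then 1 else 2)

theorem pathDefect_eq {P : Finset (Sym2 V)} {u v : V} (huv : u ≠ v) (x : V) :
    pathDefect P x = (incidenceDegree P u - if u = x then 1 else 2) +
      ((incidenceDegree P v - if v = x then 1 else 2) +
        ∑ w ∈ (Finset.univ.erase u).erase v, (incidenceDegree P w - if w = x then 1 else 2)) := by
  unfold pathDefect
  rw [Finset.add_sum_erase (Finset.univ.erase u)
      (fun w => incidenceDegree P w - if w = x then 1 else 2) (by simp [huv.symm]),
    Finset.add_sum_erase Finset.univ
      (fun w => incidenceDegree P w - if w = x then 1 else 2) (Finset.mem_univ u)]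

theorem sum_erase_pair_congr {P Q : Finset (Sym2 V)} {u v : V}
    (hPQ : ∀ w, w ≠ u → w ≠ v → incidenceDegree P w = incidenceDegree Q w) :
    ∑ w ∈ (Finset.univ.erase u).erase v, (incidenceDegree P w - if w = v then 1 else 2) =
      ∑ w ∈ (Finset.univ.erase u).erase v, (incidenceDegree Q w - if w = u then 1 else 2) := by
  refine Finset.sum_congr rfl fun w hw => ?_
  simp only [Finset.mem_erase, Finset.mem_univ, and_true] at hw
  rw [hPQ w hw.2 hw.1, if_neg hw.1, if_neg hw.2]

/-- Each vertex is allowed degree 2, the current endpoint degree 1, and only the excess counts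
(truncated subtraction). Moving to a new vertex raises both degree and allowance of `u` by one, and
`v` gets degree 1. -/
theorem pathDefect_insert_le {P : Finset (Sym2 V)} {u v : V} (huv : u ≠ v)
    (hv : incidenceDegree P v = 0) :
    pathDefect (insert s(u, v) P) v ≤ pathDefect P u := by
  have he : s(u, v) ∉ P := by
    intro hm
    rw [incidenceDegree, Finset.card_eq_zero, Finset.filter_eq_empty_iff] at hv
    exact hv hm (Sym2.mem_mk_right u v)
  rw [pathDefect_eq huv, pathDefect_eq huv, sum_erase_pair_congr (Q := P)]
  · rw [incidenceDegree_insert he, incidenceDegree_insert he]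
    simp [huv, huv.symm, hv]
  · intro w hwu hwv
    rw [incidenceDegree_insert he]
    simp [hwu, hwv]

/-- At `v` degree and allowance both drop by one. At `u` the degree drops and the allowance rises,
so a positive excess, present once the degree is at least 2, strictly decreases. -/
theorem pathDefect_erase_le {P : Finset (Sym2 V)} {u v : V} (huv : u ≠ v) (he : s(u, v) ∈ P) :
    pathDefect (P.erase s(u, v)) v + (if incidenceDegree P u = 1 then 0 else 1) ≤
      pathDefect P u := by
  rw [pathDefect_eq huv, pathDefect_eq huv, sum_erase_pair_congr (Q := P)]
  · have h1 := incidenceDegree_erase he u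
    have h2 := incidenceDegree_erase he v
    simp only [Sym2.mem_mk_left, Sym2.mem_mk_right, if_true] at h1 h2
    simp only [huv, huv.symm, if_true, if_false]
    split_ifs <;> omega
  · intro w hwu hwv
    rw [incidenceDegree_erase he w]
    simp [hwu, hwv]

theorem pathDefect_le_add_one (P : Finset (Sym2 V)) (u v : V) :
    pathDefect P v ≤ pathDefect P u + 1 := by
  by_cases huv : u = v
  · subst huv; omega
  · rw [pathDefect_eq huv, pathDefect_eq huv u, sum_erase_pair_congr (Q := P) fun _ _ _ => rfl]
    simp only [huv, Ne.symm huv, if_true, if_false]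
    omega

/-- The weight of a walk state in the recursion for the number of walks. -/
noncomputable def stateWeight (r l : ℝ) (P : Finset (Sym2 V)) (u : V) : ℝ :=
  r⁻¹ ^ P.card * l ^ pathDefect P u

/-- The share of one step, from the walk `u :: h` to the vertex `v`. -/
noncomputable def stepWeight (r l N : ℝ) (u : V) (h : List V) (v : V) : ℝ :=
  if v ∈ u :: h then
    if s(u, v) ∈ pendingEdges (u :: h) ∧ incidenceDegree (pendingEdges (u :: h)) u = 1 then r
    else r / l
  else r / N

theorem stateWeight_pos {r l : ℝ} (hr : 0 < r) (hl : 0 < l) (P : Finset (Sym2 V)) (u : V) :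
    0 < stateWeight r l P u := by
  unfold stateWeight; positivity

/-- The four kinds of steps. A new vertex costs `c / r = r / N` with no gain in defect. Retracing a
pending edge gains `r`; if `u` has another pending edge, the loss of one unit of defect reduces this
to `r / l`. Any other step to an old vertex gains at most a factor `l`, and `l ≤ r / l`. -/
theorem stateWeight_step_le {r l N c : ℝ} (hN : 0 < N) (hl : 1 ≤ l) (hr : l ^ 2 ≤ r)
    (hc : c * N = r ^ 2) (u v : V) (h : List V) :
    (if v ∈ u :: h then 1 else c) * stateWeight r l (pendingEdges (v :: u :: h)) v ≤
      stepWeight r l N u h v * stateWeight r l (pendingEdges (u :: h)) u := by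
  have hl0 : 0 < l := by linarith
  have hr0 : 0 < r := lt_of_lt_of_le (by positivity) hr
  have hlr : l ≤ r / l := by rw [le_div_iff₀ hl0]; nlinarith
  rw [pendingEdges, stepWeight]
  set P := pendingEdges (u :: h) with hP
  by_cases hv : v ∈ u :: h
  · simp only [hv, if_true, one_mul]
    by_cases he : s(u, v) ∈ P
    · have huv : u ≠ v := by
        have := not_isDiag_of_mem_pendingEdges he
        rwa [Sym2.mk_isDiag_iff] at this
      have hcard : P.card = (P.erase s(u, v)).card + 1 := (Finset.card_erase_add_one he).symm
      have hd := pathDefect_erase_le huv he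
      have key : r⁻¹ ^ (P.erase s(u, v)).card = r * r⁻¹ ^ P.card := by
        rw [hcard, pow_succ]; field_simp
      simp only [he, true_and]
      unfold stateWeight
      rw [key]
      split_ifs at hd ⊢ with h1
      · rw [mul_assoc]
        gcongr
        omega
      · have : l * l ^ pathDefect (P.erase s(u, v)) v ≤ l ^ pathDefect P u := by
          rw [← pow_succ']
          exact pow_le_pow_right₀ hl hd
        calc r * r⁻¹ ^ P.card * l ^ pathDefect (P.erase s(u, v)) v
            = r / l * (r⁻¹ ^ P.card * (l * l ^ pathDefect (P.erase s(u, v)) v)) := by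
              field_simp
          _ ≤ _ := by gcongr
    · rw [Finset.erase_eq_of_notMem he]
      simp only [he, false_and, if_false]
      unfold stateWeight
      calc r⁻¹ ^ P.card * l ^ pathDefect P v ≤ r⁻¹ ^ P.card * l ^ (pathDefect P u + 1) := by
            gcongr
            exact pathDefect_le_add_one P u v
        _ = l * (r⁻¹ ^ P.card * l ^ pathDefect P u) := by ring
        _ ≤ _ := by gcongr
  · simp only [hv, if_false]
    have huv : u ≠ v := by rintro rfl; simp at hv
    have hd0 : incidenceDegree P v = 0 := by
      rw [incidenceDegree, Finset.card_eq_zero, Finset.filter_eq_empty_iff]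
      exact fun e he hve => hv (mem_of_mem_pendingEdges he hve)
    have he : s(u, v) ∉ P := fun hm => hv (mem_of_mem_pendingEdges hm (Sym2.mem_mk_right u v))
    unfold stateWeight
    rw [Finset.card_insert_of_notMem he, pow_succ]
    have hc' : c = r ^ 2 / N := by rw [← hc]; field_simp
    calc c * (r⁻¹ ^ P.card * r⁻¹ * l ^ pathDefect (insert s(u, v) P) v)
        = r / N * (r⁻¹ ^ P.card * l ^ pathDefect (insert s(u, v) P) v) := by
          rw [hc']; field_simp
      _ ≤ _ := by
        gcongr
        exact pathDefect_insert_le huv hd0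

/-- At most `N` new vertices with share `r / N`, at most `l` old ones with share `r / l`, and at
most one forced retracing with share `r`. -/
theorem sum_stepWeight_le {r l N : ℝ} (hN : (Fintype.card V : ℝ) ≤ N) (hl : 0 < l) (hr : 0 ≤ r)
    (u : V) (h : List V) (hh : ((u :: h).length : ℝ) ≤ l) :
    ∑ v, stepWeight r l N u h v ≤ 3 * r := by
  have hN0 : 0 ≤ N := (Nat.cast_nonneg _).trans hN
  set P := pendingEdges (u :: h) with hP
  have h1 : ∀ v, stepWeight r l N u h v ≤ r / N + (if v ∈ u :: h then r / l else 0) +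
      (if s(u, v) ∈ P ∧ incidenceDegree P u = 1 then r else 0) := by
    intro v
    have := div_nonneg hr hN0
    have := div_nonneg hr hl.le
    unfold stepWeight
    rw [← hP]
    split_ifs <;> linarith
  refine (Finset.sum_le_sum fun v _ => h1 v).trans ?_
  rw [Finset.sum_add_distrib, Finset.sum_add_distrib]
  have e1 : ∑ _v : V, r / N ≤ r := by
    rw [Finset.sum_const, nsmul_eq_mul, Finset.card_univ]
    rcases hN0.eq_or_lt with h0 | h0
    · rw [← h0]; simpa using hr
    · rw [mul_div_assoc', div_le_iff₀ h0, mul_comm r]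
      gcongr
  have e2 : ∑ v : V, (if v ∈ u :: h then r / l else 0) ≤ r := by
    rw [← Finset.sum_filter, Finset.sum_const, nsmul_eq_mul]
    have : (Finset.univ.filter fun v => v ∈ u :: h) = (u :: h).toFinset := by ext; simp
    rw [this, mul_div_assoc', div_le_iff₀ hl, mul_comm r]
    have := List.toFinset_card_le (u :: h)
    have : (((u :: h).toFinset.card : ℕ) : ℝ) ≤ l := le_trans (by exact_mod_cast this) hh
    gcongr
  -- Degree one leaves a single pending edge at `u`, hence a single `v`.
  have e3 : ∑ v : V, (if s(u, v) ∈ P ∧ incidenceDegree P u = 1 then r else 0) ≤ r := by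
    by_cases hd : incidenceDegree P u = 1
    · simp only [hd, and_true]
      rw [← Finset.sum_filter, Finset.sum_const, nsmul_eq_mul]
      have : (Finset.univ.filter fun v => s(u, v) ∈ P).card ≤ 1 := by
        rw [← hd, incidenceDegree]
        refine Finset.card_le_card_of_injOn (fun v => s(u, v)) ?_ ?_
        · intro v hv
          simpa using hv
        · intro v _ w _ hvw
          exact Sym2.congr_right.1 hvw
      have : (((Finset.univ.filter fun v => s(u, v) ∈ P).card : ℕ) : ℝ) ≤ 1 := by
        exact_mod_cast this
      nlinarith
    · simpa [hd] using hr
  linarith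

/-- The total weight of the continuations by `L` steps of the walk `h`, where a walk without
pending edges at the end has the weight `c` to the number of steps which led to a new vertex. -/
noncomputable def walkSum (c : ℝ) : ℕ → List V → ℝ
  | 0, h => if pendingEdges h = ∅ then c ^ newVertexSteps h else 0
  | L + 1, h => ∑ v, walkSum c L (v :: h)

theorem walkSum_le {r l N c : ℝ} (hN0 : 0 < N) (hN : (Fintype.card V : ℝ) ≤ N) (hl : 1 ≤ l)
    (hr : l ^ 2 ≤ r) (hc : c * N = r ^ 2) (L : ℕ) (u : V) (h : List V)
    (hh : ((u :: h).length + L : ℝ) ≤ l) :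
    walkSum c L (u :: h) ≤
      (3 * r) ^ L * (stateWeight r l (pendingEdges (u :: h)) u * c ^ newVertexSteps (u :: h)) := by
  have hl0 : 0 < l := by linarith
  have hr0 : 0 < r := lt_of_lt_of_le (by positivity) hr
  have hc0 : 0 ≤ c := by
    have : c = r ^ 2 / N := by rw [← hc]; field_simp
    rw [this]; positivity
  induction L generalizing u h with
  | zero =>
    rw [walkSum]
    split_ifs with hp
    · rw [hp, stateWeight, Finset.card_empty, pow_zero, pow_zero, one_mul, one_mul]
      exact le_mul_of_one_le_left (by positivity) (one_le_pow₀ hl)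
    · have := (stateWeight_pos hr0 hl0 (pendingEdges (u :: h)) u).le
      positivity
  | succ L ih =>
    rw [walkSum]
    have hlen : ((u :: h).length : ℝ) ≤ l := by
      push_cast at hh ⊢
      have : (0 : ℝ) ≤ L := Nat.cast_nonneg _
      linarith
    calc ∑ v, walkSum c L (v :: u :: h)
        ≤ ∑ v, (3 * r) ^ L * (stepWeight r l N u h v *
            (stateWeight r l (pendingEdges (u :: h)) u * c ^ newVertexSteps (u :: h))) := by
          refine Finset.sum_le_sum fun v _ => (ih v (u :: h) ?_).trans ?_
          · push_cast [List.length_cons] at hh ⊢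
            linarith
          · refine mul_le_mul_of_nonneg_left ?_ (by positivity)
            have := mul_le_mul_of_nonneg_right (stateWeight_step_le hN0 hl hr hc u v h)
              (pow_nonneg hc0 (newVertexSteps (u :: h)))
            refine le_trans (le_of_eq ?_) (this.trans (le_of_eq (by ring)))
            rw [newVertexSteps, pow_add]
            split_ifs <;> ring
      _ = (∑ v, stepWeight r l N u h v) * ((3 * r) ^ L *
            (stateWeight r l (pendingEdges (u :: h)) u * c ^ newVertexSteps (u :: h))) := by
          rw [Finset.sum_mul]
          exact Finset.sum_congr rfl fun v _ => by ring
      _ ≤ 3 * r * ((3 * r) ^ L *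
            (stateWeight r l (pendingEdges (u :: h)) u * c ^ newVertexSteps (u :: h))) := by
          have := (stateWeight_pos hr0 hl0 (pendingEdges (u :: h)) u).le
          gcongr
          exact sum_stepWeight_le hN hl0 hr0.le u h hlen
      _ = _ := by ring

theorem walkSum_singleton_le {r l N c : ℝ} (hN0 : 0 < N) (hN : (Fintype.card V : ℝ) ≤ N)
    (hr : l ^ 2 ≤ r) (hc : c * N = r ^ 2) (L : ℕ) (hL : (L + 1 : ℝ) ≤ l) (u : V) :
    walkSum c L [u] ≤ (3 * r) ^ L := by
  have hl : 1 ≤ l := by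
    have : (0 : ℝ) ≤ L := Nat.cast_nonneg _
    linarith
  have := walkSum_le hN0 hN hl hr hc L u []
    (by push_cast [List.length_cons, List.length_nil]; linarith)
  simpa [stateWeight, pendingEdges, newVertexSteps, pathDefect, incidenceDegree] using this

end Walks

/-! ### Symmetric matrices in terms of their independent entries. -/

section SymmMatrix

variable {n : ℕ}

/-- The symmetric matrix with zero diagonal and given entries above the diagonal. -/
def symmMatrix (f : NodePair n → ℝ) : Matrix (Fin n) (Fin n) ℝ :=
  Matrix.of fun i j => if h : i < j then f ⟨(i, j), h⟩ else if h : j < i then f ⟨(j, i), h⟩ else 0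

theorem symmMatrix_comm (f : NodePair n → ℝ) (i j : Fin n) :
    symmMatrix f i j = symmMatrix f j i := by
  simp only [symmMatrix, Matrix.of_apply]
  rcases lt_trichotomy i j with h | h | h
  · simp [h, h.not_gt]
  · simp [h]
  · simp [h, h.not_gt]

theorem symmMatrix_of_lt (f : NodePair n → ℝ) {i j : Fin n} (h : i < j) :
    symmMatrix f i j = f ⟨(i, j), h⟩ := by
  simp [symmMatrix, h]

theorem symmMatrix_self (f : NodePair n → ℝ) (i : Fin n) : symmMatrix f i i = 0 := by
  simp [symmMatrix]

/-- The entries of `symmMatrix f` as a function on unordered pairs. -/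
def edgeValue (f : NodePair n → ℝ) : Sym2 (Fin n) → ℝ :=
  Sym2.lift ⟨fun i j => symmMatrix f i j, symmMatrix_comm f⟩

theorem edgeValue_mk (f : NodePair n → ℝ) (i j : Fin n) :
    edgeValue f s(i, j) = symmMatrix f i j := rfl

/-- The unordered pair of nodes underlying an element of `NodePair n`. -/
def NodePair.edge (p : NodePair n) : Sym2 (Fin n) := s(p.1.1, p.1.2)

theorem NodePair.edge_injective : Function.Injective (NodePair.edge (n := n)) := by
  rintro ⟨⟨a, b⟩, h⟩ ⟨⟨c, d⟩, h'⟩ he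
  simp only [NodePair.edge, Sym2.eq_iff] at he
  rcases he with ⟨rfl, rfl⟩ | ⟨rfl, rfl⟩
  · rfl
  · exact absurd h (lt_asymm h')

theorem edgeValue_edge (f : NodePair n → ℝ) (p : NodePair n) : edgeValue f p.edge = f p := by
  obtain ⟨⟨a, b⟩, h⟩ := p
  exact symmMatrix_of_lt f h

theorem exists_edge_eq {e : Sym2 (Fin n)} (he : ¬ e.IsDiag) : ∃ p : NodePair n, p.edge = e := by
  induction e with
  | _ a b =>
    rw [Sym2.mk_isDiag_iff] at he
    rcases lt_or_gt_of_ne he with h | h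
    · exact ⟨⟨(a, b), h⟩, rfl⟩
    · exact ⟨⟨(b, a), h⟩, Sym2.eq_swap⟩

theorem edgeValue_of_isDiag (f : NodePair n → ℝ) {e : Sym2 (Fin n)} (he : e.IsDiag) :
    edgeValue f e = 0 := by
  induction e with
  | _ a b =>
    rw [Sym2.mk_isDiag_iff] at he
    subst he
    exact symmMatrix_self f a

theorem toFinset_subset_image_edge {l : List (Sym2 (Fin n))} (hl : ∀ e ∈ l, ¬ e.IsDiag) :
    l.toFinset ⊆ (Finset.univ.filter fun p : NodePair n => l.count p.edge ≠ 0).image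
      NodePair.edge := by
  intro e he
  rw [List.mem_toFinset] at he
  obtain ⟨p, rfl⟩ := exists_edge_eq (hl e he)
  refine Finset.mem_image_of_mem _ ?_
  simpa [List.count_eq_zero] using he

/-- Grouping the factors by edge yields powers of independent variables, so that the integral
factorizes. -/
theorem prod_map_edgeValue (f : NodePair n → ℝ) {l : List (Sym2 (Fin n))}
    (hl : ∀ e ∈ l, ¬ e.IsDiag) :
    (l.map (edgeValue f)).prod = ∏ p : NodePair n, f p ^ l.count p.edge := by
  rw [Finset.prod_list_map_count]
  have hsub : l.toFinset ⊆ Finset.univ.image (NodePair.edge (n := n)) :=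
    (toFinset_subset_image_edge hl).trans (Finset.image_subset_image (Finset.filter_subset _ _))
  rw [Finset.prod_subset hsub, Finset.prod_image fun p _ q _ h => NodePair.edge_injective h]
  · simp_rw [edgeValue_edge]
  · intro e _ he
    rw [List.mem_toFinset, ← List.count_eq_zero] at he
    rw [he, pow_zero]

theorem sum_symmMatrix_row (f : NodePair n → ℝ) (i : Fin n) :
    ∑ j, symmMatrix f i j = ∑ p : NodePair n, if p.1.1 = i ∨ p.1.2 = i then f p else 0 := by
  have h1 : ∑ p : NodePair n, (if p.1.1 = i ∨ p.1.2 = i then f p else 0) =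
      ∑ x ∈ Finset.univ.filter (fun x : Fin n × Fin n => x.1 < x.2),
        if x.1 = i ∨ x.2 = i then symmMatrix f x.1 x.2 else 0 := by
    rw [Finset.sum_subtype (p := fun x : Fin n × Fin n => x.1 < x.2) _ (fun x => by simp)]
    refine Finset.sum_congr rfl fun p _ => ?_
    rw [symmMatrix_of_lt f p.2]
  rw [h1, Finset.sum_filter, Fintype.sum_prod_type]
  have h2 : ∀ a b : Fin n,
      (if a < b then (if a = i ∨ b = i then symmMatrix f a b else 0) else 0) =
      (if a = i then (if i < b then symmMatrix f i b else 0) else 0) +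
      (if b = i then (if a < i then symmMatrix f i a else 0) else 0) := by
    intro a b
    by_cases ha : a = i
    · subst ha
      by_cases hb : b = a
      · subst hb; simp
      · simp [hb]
    · by_cases hb : b = i
      · subst hb; simp [ha, symmMatrix_comm f a b]
      · simp [ha, hb]
  simp only [h2, Finset.sum_add_distrib]
  rw [Finset.sum_comm]
  simp only [Finset.sum_ite_eq', Finset.mem_univ, if_true]
  rw [← Finset.sum_add_distrib]
  refine Finset.sum_congr rfl fun j _ => ?_
  rcases lt_trichotomy i j with h | h | h
  · simp [h, h.not_gt]
  · subst h; simp [symmMatrix_self]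
  · simp [h, h.not_gt]

end SymmMatrix

/-! ### Expected traces of powers. -/

section Moments

variable {n : ℕ} {ν : NodePair n → Measure (Bool × Bool)} [∀ p, IsProbabilityMeasure (ν p)]
  {g : NodePair n → Bool × Bool → ℝ} {c : ℝ}

theorem integral_prod_map_edgeValue_eq_zero (h0 : ∀ p, ∫ b, g p b ∂ν p = 0)
    {l : List (Sym2 (Fin n))} {e : Sym2 (Fin n)} (he : l.count e = 1) :
    ∫ x, (l.map (edgeValue fun p => g p (x p))).prod ∂Measure.pi ν = 0 := by
  by_cases hl : ∀ e ∈ l, ¬ e.IsDiag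
  · simp_rw [prod_map_edgeValue _ hl]
    rw [integral_fintype_prod_eq_prod (fun p b => g p b ^ l.count p.edge)]
    obtain ⟨p, rfl⟩ := exists_edge_eq (hl e (List.count_pos_iff.1 (by omega)))
    refine Finset.prod_eq_zero (Finset.mem_univ p) ?_
    simp [he, h0]
  · push Not at hl
    obtain ⟨e, he, hd⟩ := hl
    have : ∀ x : NodePair n → Bool × Bool,
        (l.map (edgeValue fun p => g p (x p))).prod = 0 := fun x =>
      List.prod_eq_zero (List.mem_map.2 ⟨e, he, edgeValue_of_isDiag _ hd⟩)
    simp [this]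

theorem abs_integral_pow_le (μ : Measure (Bool × Bool)) [IsProbabilityMeasure μ]
    {f : Bool × Bool → ℝ} (h1 : ∀ b, |f b| ≤ 1) (h2 : ∫ b, f b ^ 2 ∂μ ≤ c) {m : ℕ} (hm : 2 ≤ m) :
    |∫ b, f b ^ m ∂μ| ≤ c := by
  refine abs_integral_le_integral_abs.trans (le_trans ?_ h2)
  refine integral_mono Integrable.of_finite Integrable.of_finite fun b => ?_
  simp only [abs_pow]
  rw [← sq_abs (f b)]
  exact pow_le_pow_of_le_one (abs_nonneg _) (h1 b) hm

/-- Each edge that occurs does so at least twice, and for entries bounded by 1 the higher moments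
are at most the second. A loop makes the product vanish. -/
theorem integral_prod_map_edgeValue_le (hc0 : 0 ≤ c) (hc1 : c ≤ 1) (h1 : ∀ p b, |g p b| ≤ 1)
    (h2 : ∀ p, ∫ b, g p b ^ 2 ∂ν p ≤ c)
    {l : List (Sym2 (Fin n))} (hl1 : ∀ e, l.count e ≠ 1) :
    ∫ x, (l.map (edgeValue fun p => g p (x p))).prod ∂Measure.pi ν ≤ c ^ l.toFinset.card := by
  by_cases hl : ∀ e ∈ l, ¬ e.IsDiag
  · simp_rw [prod_map_edgeValue _ hl]
    rw [integral_fintype_prod_eq_prod (fun p b => g p b ^ l.count p.edge)]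
    refine (le_abs_self _).trans ?_
    rw [Finset.abs_prod]
    calc ∏ p, |∫ b, g p b ^ l.count p.edge ∂ν p|
        ≤ ∏ p : NodePair n, if l.count p.edge ≠ 0 then c else 1 := by
          refine Finset.prod_le_prod (fun _ _ => abs_nonneg _) fun p _ => ?_
          split_ifs with h
          · refine abs_integral_pow_le _ (h1 p) (h2 p) ?_
            have := hl1 p.edge
            omega
          · push Not at h
            simp [h]
      _ = c ^ (Finset.univ.filter fun p : NodePair n => l.count p.edge ≠ 0).card := by
          rw [← Finset.prod_filter, Finset.prod_const]
      _ ≤ c ^ l.toFinset.card :=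
          pow_le_pow_of_le_one hc0 hc1
            ((Finset.card_le_card (toFinset_subset_image_edge hl)).trans Finset.card_image_le)
  · push Not at hl
    obtain ⟨e, he, hd⟩ := hl
    have : ∀ x : NodePair n → Bool × Bool,
        (l.map (edgeValue fun p => g p (x p))).prod = 0 := fun x =>
      List.prod_eq_zero (List.mem_map.2 ⟨e, he, edgeValue_of_isDiag _ hd⟩)
    simp only [this, integral_zero]
    positivity

theorem integral_walk_prod_le (hc0 : 0 ≤ c) (hc1 : c ≤ 1) (h0 : ∀ p, ∫ b, g p b ∂ν p = 0)
    (h1 : ∀ p b, |g p b| ≤ 1) (h2 : ∀ p, ∫ b, g p b ^ 2 ∂ν p ≤ c) (h : List (Fin n)) :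
    ∫ x, ((walkEdges h).map (edgeValue fun p => g p (x p))).prod ∂Measure.pi ν ≤
      if pendingEdges h = ∅ then c ^ newVertexSteps h else 0 := by
  by_cases hp : ∃ e, (walkEdges h).count e = 1
  · obtain ⟨e, he⟩ := hp
    rw [integral_prod_map_edgeValue_eq_zero h0 he]
    split_ifs <;> positivity
  · push Not at hp
    rw [if_pos]
    · exact (integral_prod_map_edgeValue_le hc0 hc1 h1 h2 hp).trans
        (pow_le_pow_of_le_one hc0 hc1 (newVertexSteps_le_card h))
    · exact Finset.eq_empty_of_forall_notMem fun e he =>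
        hp e (count_walkEdges_of_mem_pendingEdges he)

/-- Expanding one factor of the power prolongs the walk by one vertex, which is the recursion of
`walkSum`. -/
theorem integral_walk_mul_pow_le (hc0 : 0 ≤ c) (hc1 : c ≤ 1) (h0 : ∀ p, ∫ b, g p b ∂ν p = 0)
    (h1 : ∀ p b, |g p b| ≤ 1) (h2 : ∀ p, ∫ b, g p b ^ 2 ∂ν p ≤ c) (i : Fin n) (L : ℕ)
    (u : Fin n) (h : List (Fin n)) :
    ∫ x, ((walkEdges (u :: h)).map (edgeValue fun p => g p (x p))).prod *
      ((symmMatrix fun p => g p (x p)) ^ L) u i ∂Measure.pi ν ≤ walkSum c L (u :: h) := by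
  induction L generalizing u h with
  | zero =>
    have := integral_walk_prod_le hc0 hc1 h0 h1 h2 (u :: h)
    rw [walkSum]
    -- `walkSum` also counts walks that do not close up at `i`; their integral is 0 and the bound is
    -- nonnegative.
    by_cases hui : u = i
    · simpa [hui] using this
    · simp only [pow_zero, Matrix.one_apply_ne hui, mul_zero, integral_zero]
      split_ifs <;> positivity
  | succ L ih =>
    rw [walkSum]
    refine le_trans (le_of_eq ?_) (Finset.sum_le_sum fun v _ => ih v (u :: h))
    rw [← integral_finsetSum _ fun _ _ => Integrable.of_finite]
    refine integral_congr_ae (Filter.Eventually.of_forall fun x => ?_)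
    simp only [pow_succ', Matrix.mul_apply, walkEdges, List.map_cons, List.prod_cons,
      edgeValue_mk, Finset.mul_sum]
    exact Finset.sum_congr rfl fun v _ => by ring

/-- A bound for the expected trace of powers of a symmetric random matrix with independent,
centered, bounded entries of small variance. -/
theorem integral_trace_pow_le (hc0 : 0 ≤ c) (hc1 : c ≤ 1) (h0 : ∀ p, ∫ b, g p b ∂ν p = 0)
    (h1 : ∀ p b, |g p b| ≤ 1) (h2 : ∀ p, ∫ b, g p b ^ 2 ∂ν p ≤ c) {r : ℝ} {L : ℕ} (hn : 0 < n)
    (hr : (L + 1 : ℝ) ^ 2 ≤ r) (hc : c * n = r ^ 2) :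
    ∫ x, ((symmMatrix fun p => g p (x p)) ^ L).trace ∂Measure.pi ν ≤ n * (3 * r) ^ L := by
  simp only [Matrix.trace, Matrix.diag_apply]
  rw [integral_finsetSum _ fun _ _ => Integrable.of_finite]
  have : ∀ i : Fin n, ∫ x, ((symmMatrix fun p => g p (x p)) ^ L) i i ∂Measure.pi ν ≤
      (3 * r) ^ L := by
    intro i
    have hw := integral_walk_mul_pow_le hc0 hc1 h0 h1 h2 i L i []
    simp only [walkEdges, List.map_nil, List.prod_nil, one_mul] at hw
    exact hw.trans (walkSum_singleton_le (N := n) (by exact_mod_cast hn) (by simp) hr hc L le_rfl i)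
  refine (Finset.sum_le_sum fun i _ => this i).trans ?_
  simp

end Moments

/-! ### From traces to the spectral norm. -/

section SpectralBound

open Matrix

variable {V : Type*} [Fintype V] [DecidableEq V]

/-- The base case is the Hilbert–Schmidt bound. The induction passes to M² and θ², since |Mx|² = ⟨x,
M²x⟩ ≤ |x| |M²x|; hence the exponents are powers of two. -/
theorem mulVec_dotProduct_self_le_of_trace {r : ℕ} :
    ∀ {M : Matrix V V ℝ} {θ : ℝ}, Mᵀ = M → 0 ≤ θ → (M ^ 2 ^ (r + 1)).trace ≤ θ ^ 2 ^ (r + 1) →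
      ∀ x : V → ℝ, (M *ᵥ x) ⬝ᵥ (M *ᵥ x) ≤ θ ^ 2 * (x ⬝ᵥ x) := by
  induction r with
  | zero =>
    intro M θ hM _ ht x
    have h1 : (M ^ 2 ^ (0 + 1)).trace = ∑ i, ∑ j, M i j ^ 2 := by
      simp only [zero_add, pow_one, pow_two M, Matrix.trace, Matrix.diag_apply, Matrix.mul_apply]
      refine Finset.sum_congr rfl fun i _ => Finset.sum_congr rfl fun j _ => ?_
      rw [← Matrix.transpose_apply M i j, hM, sq]
    rw [h1] at ht
    calc (M *ᵥ x) ⬝ᵥ (M *ᵥ x) = ∑ i, (∑ j, M i j * x j) ^ 2 := by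
          simp only [dotProduct, mulVec, sq]
      _ ≤ ∑ i, (∑ j, M i j ^ 2) * (∑ j, x j ^ 2) :=
          Finset.sum_le_sum fun i _ => Finset.sum_mul_sq_le_sq_mul_sq _ _ _
      _ = (∑ i, ∑ j, M i j ^ 2) * (x ⬝ᵥ x) := by
          rw [← Finset.sum_mul]; simp only [dotProduct, sq]
      _ ≤ _ := by
          refine mul_le_mul_of_nonneg_right (by simpa using ht) ?_
          exact Finset.sum_nonneg fun i _ => mul_self_nonneg _
  | succ r ih =>
    intro M θ hM hθ ht x
    have hM2 : (M ^ 2)ᵀ = M ^ 2 := by rw [Matrix.transpose_pow, hM]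
    have h := ih hM2 (sq_nonneg θ) (by rw [← pow_mul, ← pow_mul, ← pow_succ']; exact ht) x
    have hx : 0 ≤ x ⬝ᵥ x := Finset.sum_nonneg fun i _ => mul_self_nonneg _
    have hy : 0 ≤ (M *ᵥ x) ⬝ᵥ (M *ᵥ x) := Finset.sum_nonneg fun i _ => mul_self_nonneg _
    have e : (M *ᵥ x) ⬝ᵥ (M *ᵥ x) = x ⬝ᵥ ((M ^ 2) *ᵥ x) := by
      rw [sq, ← Matrix.mulVec_mulVec, Matrix.dotProduct_mulVec x, ← Matrix.mulVec_transpose, hM]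
    have cs : (x ⬝ᵥ ((M ^ 2) *ᵥ x)) ^ 2 ≤ (x ⬝ᵥ x) * (((M ^ 2) *ᵥ x) ⬝ᵥ ((M ^ 2) *ᵥ x)) := by
      have := Finset.sum_mul_sq_le_sq_mul_sq Finset.univ x ((M ^ 2) *ᵥ x)
      simpa only [dotProduct, sq] using this
    rw [← e] at cs
    refine abs_le_of_sq_le_sq' ?_ (by positivity) |>.2
    calc _ ≤ _ := cs
      _ ≤ (x ⬝ᵥ x) * ((θ ^ 2) ^ 2 * (x ⬝ᵥ x)) := by gcongr
      _ = _ := by ring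

end SpectralBound

/-! ### Spectral tail bound by Markov's inequality. -/

section Tails

open Matrix

variable {n : ℕ} {ν : NodePair n → Measure (Bool × Bool)} [∀ p, IsProbabilityMeasure (ν p)]
  {g : NodePair n → Bool × Bool → ℝ} {c : ℝ}

/-- A tail bound for the spectral norm of a symmetric random matrix with independent, centered,
bounded entries of small variance. -/
theorem measureReal_spectral_tail_le (hc0 : 0 ≤ c) (hc1 : c ≤ 1) (h0 : ∀ p, ∫ b, g p b ∂ν p = 0)
    (h1 : ∀ p b, |g p b| ≤ 1) (h2 : ∀ p, ∫ b, g p b ^ 2 ∂ν p ≤ c) {r : ℝ} {j : ℕ} (hn : 0 < n)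
    (hr : ((2 ^ (j + 1) : ℕ) + 1 : ℝ) ^ 2 ≤ r) (hc : c * n = r ^ 2) :
    (Measure.pi ν).real {x | ¬ ∀ y : Fin n → ℝ,
      ((symmMatrix fun p => g p (x p)) *ᵥ y) ⬝ᵥ ((symmMatrix fun p => g p (x p)) *ᵥ y) ≤
        (6 * r) ^ 2 * (y ⬝ᵥ y)} ≤ n / 2 ^ 2 ^ (j + 1) := by
  have hr0 : 0 < r := lt_of_lt_of_le (by positivity) hr
  have hT : ∀ f : NodePair n → ℝ, (symmMatrix f)ᵀ = symmMatrix f := fun f => by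
    ext a b; exact symmMatrix_comm f b a
  have hsub : {x : NodePair n → Bool × Bool | ¬ ∀ y : Fin n → ℝ,
      ((symmMatrix fun p => g p (x p)) *ᵥ y) ⬝ᵥ ((symmMatrix fun p => g p (x p)) *ᵥ y) ≤
        (6 * r) ^ 2 * (y ⬝ᵥ y)} ⊆ {x : NodePair n → Bool × Bool | (6 * r) ^ 2 ^ (j + 1) ≤
          ((symmMatrix fun p => g p (x p)) ^ 2 ^ (j + 1)).trace} := by
    intro x hx
    by_contra hlt
    simp only [Set.mem_ofPred_eq, not_le] at hlt
    exact hx (mulVec_dotProduct_self_le_of_trace (hT _) (by positivity) hlt.le)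
  refine (measureReal_mono hsub).trans ?_
  have hnn : ∀ x : NodePair n → Bool × Bool,
      0 ≤ ((symmMatrix fun p => g p (x p)) ^ 2 ^ (j + 1)).trace := by
    intro x
    set M := symmMatrix fun p => g p (x p)
    have : M ^ 2 ^ (j + 1) = (M ^ 2 ^ j)ᵀ * M ^ 2 ^ j := by
      rw [Matrix.transpose_pow, hT, ← pow_add]
      congr 1; ring
    rw [this]
    simp only [Matrix.trace, Matrix.diag_apply, Matrix.mul_apply, Matrix.transpose_apply]
    exact Finset.sum_nonneg fun _ _ => Finset.sum_nonneg fun _ _ => mul_self_nonneg _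
  have hm := mul_meas_ge_le_integral_of_nonneg (μ := Measure.pi ν)
    (Filter.Eventually.of_forall hnn) Integrable.of_finite ((6 * r) ^ 2 ^ (j + 1))
  have hi := hm.trans (integral_trace_pow_le hc0 hc1 h0 h1 h2 hn hr hc)
  rw [le_div_iff₀ (by positivity)]
  -- The threshold is twice the bound `3 * r` per step; the factor 2 becomes the decay of the
  -- probability.
  have e : (6 * r) ^ 2 ^ (j + 1) = (3 * r) ^ 2 ^ (j + 1) * 2 ^ 2 ^ (j + 1) := by
    rw [← mul_pow]; ring
  rw [e] at hi
  have h3 : 0 < (3 * r) ^ 2 ^ (j + 1) := by positivity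
  refine le_of_mul_le_mul_left ?_ h3
  calc _ = _ := by rw [mul_comm (Measure.real _ _), ← mul_assoc, e]
    _ ≤ _ := hi
    _ = _ := by ring

end Tails

/-! ### Min-max bounds for eigenvalues. -/

section CourantFischer

open Matrix Module

variable {n : ℕ} {X : Matrix (Fin n) (Fin n) ℝ}

theorem sum_eigenvectorBasis_dotProduct_mul (hX : X.IsHermitian) (x y : Fin n → ℝ) :
    ∑ i, ((hX.eigenvectorBasis i).ofLp ⬝ᵥ x) * ((hX.eigenvectorBasis i).ofLp ⬝ᵥ y) = x ⬝ᵥ y := by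
  have h := hX.eigenvectorBasis.sum_inner_mul_inner (WithLp.toLp 2 x) (WithLp.toLp 2 y)
  simp only [EuclideanSpace.inner_eq_star_dotProduct, star_trivial] at h
  rw [dotProduct_comm x y, ← h]
  exact Finset.sum_congr rfl fun i _ => by
    rw [dotProduct_comm y]

theorem eigenvectorBasis_dotProduct_mulVec (hX : X.IsHermitian) (i : Fin n) (x : Fin n → ℝ) :
    (hX.eigenvectorBasis i).ofLp ⬝ᵥ (X *ᵥ x) =
      hX.eigenvalues i * ((hX.eigenvectorBasis i).ofLp ⬝ᵥ x) := by
  have hT : Xᵀ = X := (show X.IsSymm by simpa using hX)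
  rw [dotProduct_mulVec, ← mulVec_transpose, hT, hX.mulVec_eigenvectorBasis, smul_dotProduct,
    smul_eq_mul]

theorem dotProduct_mulVec_eq_sum_eigenvalues (hX : X.IsHermitian) (x : Fin n → ℝ) :
    x ⬝ᵥ (X *ᵥ x) =
      ∑ i, hX.eigenvalues i * ((hX.eigenvectorBasis i).ofLp ⬝ᵥ x) ^ 2 := by
  rw [← sum_eigenvectorBasis_dotProduct_mul hX x (X *ᵥ x)]
  refine Finset.sum_congr rfl fun i _ => ?_
  rw [eigenvectorBasis_dotProduct_mulVec]
  ring

/-- There are fewer linear conditions than dimensions. -/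
theorem exists_mem_forall_eigenvectorBasis_dotProduct_eq_zero (hX : X.IsHermitian)
    (W : Submodule ℝ (Fin n → ℝ)) (T : Finset (Fin n)) (hT : T.card < finrank ℝ W) :
    ∃ x ∈ W, 0 < x ⬝ᵥ x ∧ ∀ i ∈ T, (hX.eigenvectorBasis i).ofLp ⬝ᵥ x = 0 := by
  let φ : W →ₗ[ℝ] (T → ℝ) :=
    (LinearMap.pi fun i : T => dotProductBilin ℝ ℝ (hX.eigenvectorBasis i.1).ofLp) ∘ₗ W.subtype
  have hlt : finrank ℝ (T → ℝ) < finrank ℝ W := by simpa using hT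
  obtain ⟨⟨x, hxW⟩, hx, hne⟩ := Submodule.exists_mem_ne_zero_of_ne_bot
    (LinearMap.ker_ne_bot_of_finrank_lt (f := φ) hlt)
  have hx0 : x ≠ 0 := fun h => hne (by simpa using h)
  refine ⟨x, hxW, ?_, fun i hi => ?_⟩
  · refine lt_of_le_of_ne (Finset.sum_nonneg fun i _ => mul_self_nonneg _) fun h => hx0 ?_
    exact dotProduct_self_eq_zero.1 h.symm
  · exact congrFun (LinearMap.mem_ker.1 hx) ⟨i, hi⟩

theorem eigval_le_of_forall_mem (hX : X.IsHermitian) {l : ℕ} (hl : 1 ≤ l) (hln : l ≤ n) {a : ℝ}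
    (W : Submodule ℝ (Fin n → ℝ)) (hW : l ≤ finrank ℝ W)
    (h : ∀ x ∈ W, x ⬝ᵥ (X *ᵥ x) ≤ a * (x ⬝ᵥ x)) : eigval X l ≤ a := by
  have hlt : n - l < Fintype.card (Fin n) := by rw [Fintype.card_fin]; omega
  rw [eigval, dif_pos ⟨hX, hl, hln⟩]
  set m : Fin (Fintype.card (Fin n)) := ⟨n - l, hlt⟩
  set σ : Fin (Fintype.card (Fin n)) ≃ Fin n := Fintype.equivOfCardEq (Fintype.card_fin _)
  -- `eigenvalues₀` is descending, so the indices above `m` belong to the `l - 1` smallest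
  -- eigenvalues.
  obtain ⟨x, hxW, hpos, hx⟩ := exists_mem_forall_eigenvectorBasis_dotProduct_eq_zero hX W
    ((Finset.Ioi m).map σ.toEmbedding) (by
      rw [Finset.card_map, Fin.card_Ioi]
      have : (m : ℕ) = n - l := rfl
      have : Fintype.card (Fin n) = n := Fintype.card_fin n
      omega)
  refine le_of_mul_le_mul_right ?_ hpos
  refine le_trans ?_ (h x hxW)
  rw [dotProduct_mulVec_eq_sum_eigenvalues hX, ← sum_eigenvectorBasis_dotProduct_mul hX x x,
    Finset.mul_sum]
  refine Finset.sum_le_sum fun i _ => ?_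
  rw [← sq]
  by_cases hi : m < σ.symm i
  · rw [hx i (Finset.mem_map.2 ⟨σ.symm i, Finset.mem_Ioi.2 hi, by simp⟩)]
    simp
  · exact mul_le_mul_of_nonneg_right (hX.eigenvalues₀_antitone (not_lt.1 hi)) (sq_nonneg _)

theorem le_eigval_of_forall_mem (hX : X.IsHermitian) {l : ℕ} (hl : 1 ≤ l) (hln : l ≤ n) {a : ℝ}
    (W : Submodule ℝ (Fin n → ℝ)) (hW : n < finrank ℝ W + l)
    (h : ∀ x ∈ W, a * (x ⬝ᵥ x) ≤ x ⬝ᵥ (X *ᵥ x)) : a ≤ eigval X l := by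
  have hlt : n - l < Fintype.card (Fin n) := by rw [Fintype.card_fin]; omega
  rw [eigval, dif_pos ⟨hX, hl, hln⟩]
  set m : Fin (Fintype.card (Fin n)) := ⟨n - l, hlt⟩
  set σ : Fin (Fintype.card (Fin n)) ≃ Fin n := Fintype.equivOfCardEq (Fintype.card_fin _)
  -- The indices below `m` belong to the `n - l` largest eigenvalues.
  obtain ⟨x, hxW, hpos, hx⟩ := exists_mem_forall_eigenvectorBasis_dotProduct_eq_zero hX W
    ((Finset.Iio m).map σ.toEmbedding) (by
      rw [Finset.card_map, Fin.card_Iio]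
      have : (m : ℕ) = n - l := rfl
      omega)
  refine le_of_mul_le_mul_right ?_ hpos
  refine (h x hxW).trans ?_
  rw [dotProduct_mulVec_eq_sum_eigenvalues hX, ← sum_eigenvectorBasis_dotProduct_mul hX x x,
    Finset.mul_sum]
  refine Finset.sum_le_sum fun i _ => ?_
  rw [← sq]
  by_cases hi : σ.symm i < m
  · rw [hx i (Finset.mem_map.2 ⟨σ.symm i, Finset.mem_Iio.2 hi, by simp⟩)]
    simp
  · exact mul_le_mul_of_nonneg_right (hX.eigenvalues₀_antitone (not_lt.1 hi)) (sq_nonneg _)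

end CourantFischer

/-! ### Deterministic perturbation of the Laplacian. -/

section Deterministic

open Matrix Module

variable {n : ℕ}

theorem dotProduct_self_nonneg_real (x : Fin n → ℝ) : 0 ≤ x ⬝ᵥ x :=
  Finset.sum_nonneg fun _ _ => mul_self_nonneg _

theorem dotProduct_sq_le (x y : Fin n → ℝ) : (x ⬝ᵥ y) ^ 2 ≤ (x ⬝ᵥ x) * (y ⬝ᵥ y) := by
  have := Finset.sum_mul_sq_le_sq_mul_sq Finset.univ x y
  simpa only [dotProduct, sq] using this

theorem le_finrank_ker_dotProduct {m : ℕ} (w : Fin m → Fin n → ℝ) :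
    n ≤ finrank ℝ (LinearMap.ker (LinearMap.pi fun i => dotProductBilin ℝ ℝ (w i))) + m := by
  have h := LinearMap.finrank_range_add_finrank_ker
    (LinearMap.pi fun i => dotProductBilin ℝ ℝ (w i) : (Fin n → ℝ) →ₗ[ℝ] (Fin m → ℝ))
  have h2 := Submodule.finrank_le
    (LinearMap.range (LinearMap.pi fun i => dotProductBilin ℝ ℝ (w i) :
      (Fin n → ℝ) →ₗ[ℝ] (Fin m → ℝ)))
  simp only [Module.finrank_fin_fun] at h h2
  omega

theorem mem_ker_dotProduct {m : ℕ} {w : Fin m → Fin n → ℝ} {x : Fin n → ℝ}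
    (hx : x ∈ LinearMap.ker (LinearMap.pi fun i => dotProductBilin ℝ ℝ (w i))) (i : Fin m) :
    w i ⬝ᵥ x = 0 :=
  congrFun (LinearMap.mem_ker.1 hx) i

/-- The eigenvalues of a symmetric matrix whose quadratic form is close to that of the identity
minus a matrix of rank two with known eigenvectors. -/
theorem eigval_of_quadratic_form_approx {X : Matrix (Fin n) (Fin n) ℝ} (hX : X.IsHermitian)
    (hn : 2 ≤ n) {a b : Fin n → ℝ} (haa : a ⬝ᵥ a = n) (hbb : b ⬝ᵥ b = n) (hab : a ⬝ᵥ b = 0)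
    {α β ε : ℝ} (hα : 0 ≤ α) (hαβ : α ≤ β)
    (h : ∀ x : Fin n → ℝ,
      |x ⬝ᵥ (X *ᵥ x) - (x ⬝ᵥ x - α / n * (a ⬝ᵥ x) ^ 2 - β / n * (b ⬝ᵥ x) ^ 2)| ≤
        ε * (x ⬝ᵥ x)) :
    |eigval X 1 - (1 - β)| ≤ ε ∧ |eigval X 2 - (1 - α)| ≤ ε ∧
      ∀ l : ℕ, 2 < l → l ≤ n → |eigval X l - 1| ≤ ε := by
  have hn0 : (0 : ℝ) < n := by exact_mod_cast (by omega : 0 < n)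
  have hba : b ⬝ᵥ a = 0 := by rw [dotProduct_comm, hab]
  have hb0 : b ≠ 0 := by rintro rfl; simp at hbb; linarith
  have hβ : 0 ≤ β := hα.trans hαβ
  -- Bessel's inequality, from the nonnegative square of the residual of the projection onto the
  -- span of `a` and `b`.
  have bessel : ∀ x : Fin n → ℝ, (a ⬝ᵥ x) ^ 2 / n + (b ⬝ᵥ x) ^ 2 / n ≤ x ⬝ᵥ x := by
    intro x
    have := dotProduct_self_nonneg_real (x - (a ⬝ᵥ x / n) • a - (b ⬝ᵥ x / n) • b)
    simp only [sub_dotProduct, dotProduct_sub, smul_dotProduct, dotProduct_smul, smul_eq_mul, haa,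
      hbb, hab, hba, dotProduct_comm x a, dotProduct_comm x b] at this
    field_simp at this ⊢
    nlinarith
  have na : ∀ x : Fin n → ℝ, 0 ≤ (a ⬝ᵥ x) ^ 2 / n := fun x => by positivity
  have nb : ∀ x : Fin n → ℝ, 0 ≤ (b ⬝ᵥ x) ^ 2 / n := fun x => by positivity
  have e1 : ∀ x : Fin n → ℝ, α / n * (a ⬝ᵥ x) ^ 2 = α * ((a ⬝ᵥ x) ^ 2 / n) := fun x => by ring
  have e2 : ∀ x : Fin n → ℝ, β / n * (b ⬝ᵥ x) ^ 2 = β * ((b ⬝ᵥ x) ^ 2 / n) := fun x => by ring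
  simp only [e1, e2, abs_le] at h
  -- Test spaces for the lower bounds: everything, the complement of `b`, the complement of `a` and
  -- `b`. For the upper bounds: the line of `b`, the plane of `a` and `b`, everything.
  refine ⟨?_, ?_, fun l hl hln => ?_⟩
  · have lo : 1 - β - ε ≤ eigval X 1 := by
      refine le_eigval_of_forall_mem hX le_rfl (by omega) ⊤ (by simp) fun x _ => ?_
      have := (h x).1
      nlinarith [bessel x, na x, nb x]
    have hi : eigval X 1 ≤ 1 - β + ε := by
      refine eigval_le_of_forall_mem hX le_rfl (by omega) (Submodule.span ℝ {b})
        (by rw [finrank_span_singleton hb0]) fun x hx => ?_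
      obtain ⟨t, rfl⟩ := Submodule.mem_span_singleton.1 hx
      have := (h (t • b)).2
      have e3 : (b ⬝ᵥ (t • b)) ^ 2 / n = (t • b) ⬝ᵥ (t • b) := by
        simp only [dotProduct_smul, smul_dotProduct, smul_eq_mul, hbb]
        field_simp
      rw [e3] at this
      have := mul_nonneg hα (na (t • b))
      linarith
    exact abs_le.2 ⟨by linarith, by linarith⟩
  · have lo : 1 - α - ε ≤ eigval X 2 := by
      have hfr := le_finrank_ker_dotProduct ![b]
      refine le_eigval_of_forall_mem hX (by omega) hn
        (LinearMap.ker (LinearMap.pi fun i => dotProductBilin ℝ ℝ (![b] i))) (by omega)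
        fun x hx => ?_
      have hbx : b ⬝ᵥ x = 0 := mem_ker_dotProduct (w := ![b]) hx 0
      have h1 := (h x).1
      have h2 := bessel x
      rw [hbx] at h1 h2
      simp only [ne_eq, OfNat.ofNat_ne_zero, not_false_eq_true, zero_pow, zero_div, mul_zero,
        add_zero, sub_zero] at h1 h2
      nlinarith
    have hi : eigval X 2 ≤ 1 - α + ε := by
      have hli : LinearIndependent ℝ ![a, b] := by
        rw [LinearIndependent.pair_iff]
        intro s t hst
        have h1 := congrArg (fun z => a ⬝ᵥ z) hst
        have h2 := congrArg (fun z => b ⬝ᵥ z) hst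
        simp only [dotProduct_add, dotProduct_smul, haa, hab, hba, hbb, smul_eq_mul, mul_zero,
          add_zero, zero_add, dotProduct_zero] at h1 h2
        exact ⟨(mul_eq_zero.1 h1).resolve_right hn0.ne', (mul_eq_zero.1 h2).resolve_right hn0.ne'⟩
      have hfr := finrank_span_eq_card hli
      rw [Matrix.range_cons, Matrix.range_cons, Matrix.range_empty, Set.union_empty,
        Set.singleton_union, Fintype.card_fin] at hfr
      refine eigval_le_of_forall_mem hX (by omega) hn (Submodule.span ℝ {a, b}) hfr.ge
        fun x hx => ?_
      have h1 := (h x).2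
      have h3 : (a ⬝ᵥ x) ^ 2 / n + (b ⬝ᵥ x) ^ 2 / n = x ⬝ᵥ x := by
        obtain ⟨s, t, rfl⟩ := Submodule.mem_span_pair.1 hx
        simp only [dotProduct_add, add_dotProduct, dotProduct_smul, smul_dotProduct, smul_eq_mul,
          haa, hab, hba, hbb]
        field_simp
        ring
      nlinarith [nb x]
    exact abs_le.2 ⟨by linarith, by linarith⟩
  · have lo : 1 - ε ≤ eigval X l := by
      have hfr := le_finrank_ker_dotProduct ![a, b]
      refine le_eigval_of_forall_mem hX (by omega) hln
        (LinearMap.ker (LinearMap.pi fun i => dotProductBilin ℝ ℝ (![a, b] i))) (by omega)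
        fun x hx => ?_
      have hax : a ⬝ᵥ x = 0 := mem_ker_dotProduct (w := ![a, b]) hx 0
      have hbx : b ⬝ᵥ x = 0 := mem_ker_dotProduct (w := ![a, b]) hx 1
      have h1 := (h x).1
      rw [hax, hbx] at h1
      simp only [ne_eq, OfNat.ofNat_ne_zero, not_false_eq_true, zero_pow, zero_div, mul_zero,
        sub_zero] at h1
      linarith
    have hi : eigval X l ≤ 1 + ε := by
      refine eigval_le_of_forall_mem hX (by omega) hln ⊤ (by simpa using hln) fun x _ => ?_
      have := (h x).2
      nlinarith [mul_nonneg hα (na x), mul_nonneg hβ (nb x)]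
    exact abs_le.2 ⟨by linarith, by linarith⟩

theorem dotProduct_normalizedSignedLaplacian_mulVec {A : Matrix (Fin n) (Fin n) ℝ}
    (hd : ∀ i, 0 < nodeDegree A i) (x : Fin n → ℝ) :
    x ⬝ᵥ (normalizedSignedLaplacian A *ᵥ x) =
      x ⬝ᵥ x - (fun i => x i / √(nodeDegree A i)) ⬝ᵥ
        (A *ᵥ fun i => x i / √(nodeDegree A i)) := by
  have h1 : invSqrtDegree A *ᵥ x = fun i => x i / √(nodeDegree A i) := by
    ext i
    rw [invSqrtDegree, mulVec_diagonal]
    ring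
  rw [normalizedSignedLaplacian, ← mulVec_mulVec, ← mulVec_mulVec, h1, dotProduct_mulVec,
    ← mulVec_transpose, invSqrtDegree, diagonal_transpose, ← invSqrtDegree, h1, signedLaplacian,
    sub_mulVec, dotProduct_sub]
  congr 1
  refine Finset.sum_congr rfl fun i _ => ?_
  have := Real.sq_sqrt (hd i).le
  have h0 : √(nodeDegree A i) ≠ 0 := (Real.sqrt_pos.2 (hd i)).ne'
  rw [mulVec_diagonal]
  field_simp
  rw [this]

/-- A difference of squares is factored: each term is O(√n/R) |x|, and their difference is O(√n/R²)
|x| by Cauchy–Schwarz, because (1/√d - 1/R)² ≤ 8 (d - R²)²/R⁶. Here 68² = 8 · 578 and 272 = 68 · (3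
+ 1). -/
theorem abs_sq_dotProduct_sub_le {d : Fin n → ℝ} {R : ℝ} (hR : 0 < R) (hd : ∀ i, R ^ 2 / 8 ≤ d i)
    (hsum : ∑ i, (d i - R ^ 2) ^ 2 ≤ 578 * R ^ 2 * n) {w : Fin n → ℝ} (hw : ∀ i, w i ^ 2 = 1)
    (x : Fin n → ℝ) :
    |(w ⬝ᵥ fun i => x i / √(d i)) ^ 2 - (w ⬝ᵥ x) ^ 2 / R ^ 2| ≤ 272 * n / R ^ 3 * (x ⬝ᵥ x) := by
  have hd0 : ∀ i, 0 < d i := fun i => lt_of_lt_of_le (by positivity) (hd i)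
  have hww : w ⬝ᵥ w = n := by
    simp only [dotProduct, ← sq, hw]; simp
  have hX : √(x ⬝ᵥ x) ^ 2 = x ⬝ᵥ x := Real.sq_sqrt (dotProduct_self_nonneg_real x)
  have hT : √(n : ℝ) ^ 2 = n := Real.sq_sqrt (Nat.cast_nonneg n)
  set X := √(x ⬝ᵥ x)
  set T := √(n : ℝ)
  have hX0 : 0 ≤ X := Real.sqrt_nonneg _
  have hT0 : 0 ≤ T := Real.sqrt_nonneg _
  set y : Fin n → ℝ := fun i => x i / √(d i) with hy
  have hyy : y ⬝ᵥ y ≤ 8 / R ^ 2 * X ^ 2 := by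
    rw [hX, dotProduct, dotProduct, Finset.mul_sum]
    refine Finset.sum_le_sum fun i _ => ?_
    have e : y i * y i = x i * x i / d i := by
      rw [hy]
      simp only
      rw [div_mul_div_comm, Real.mul_self_sqrt (hd0 i).le]
    rw [e, div_mul_eq_mul_div, div_le_div_iff₀ (hd0 i) (by positivity)]
    nlinarith [mul_le_mul_of_nonneg_left (hd i) (mul_self_nonneg (x i))]
  have hP : |w ⬝ᵥ y| ≤ 3 * T / R * X := by
    refine abs_le_of_sq_le_sq ?_ (by positivity)
    calc (w ⬝ᵥ y) ^ 2 ≤ n * (8 / R ^ 2 * X ^ 2) :=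
          (dotProduct_sq_le w y).trans (by rw [hww]; gcongr)
      _ ≤ n * (9 / R ^ 2 * X ^ 2) := by gcongr; norm_num
      _ = _ := by rw [← hT]; ring
  have hQ : |w ⬝ᵥ x / R| ≤ T / R * X := by
    refine abs_le_of_sq_le_sq ?_ (by positivity)
    have := dotProduct_sq_le w x
    rw [hww, ← hX, ← hT] at this
    rw [div_pow, div_mul_eq_mul_div, div_pow, mul_pow]
    gcongr
  have hPQ : |w ⬝ᵥ y - w ⬝ᵥ x / R| ≤ 68 * T / R ^ 2 * X := by
    refine abs_le_of_sq_le_sq ?_ (by positivity)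
    have e : w ⬝ᵥ y - w ⬝ᵥ x / R = x ⬝ᵥ fun i => w i * (1 / √(d i) - 1 / R) := by
      simp only [dotProduct, Finset.sum_div, ← Finset.sum_sub_distrib, hy]
      exact Finset.sum_congr rfl fun i _ => by ring
    have hz : (fun i => w i * (1 / √(d i) - 1 / R)) ⬝ᵥ (fun i => w i * (1 / √(d i) - 1 / R)) ≤
        8 / R ^ 6 * (578 * R ^ 2 * n) := by
      refine le_trans ?_ (mul_le_mul_of_nonneg_left hsum (by positivity))
      rw [dotProduct, Finset.mul_sum]
      refine Finset.sum_le_sum fun i _ => ?_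
      have hs : √(d i) ^ 2 = d i := Real.sq_sqrt (hd0 i).le
      have hs0 : 0 < √(d i) := Real.sqrt_pos.2 (hd0 i)
      have hdi := hd i
      generalize √(d i) = t at hs hs0 ⊢
      rw [← hs] at hdi ⊢
      have e1 : w i * (1 / t - 1 / R) * (w i * (1 / t - 1 / R)) =
          w i ^ 2 * ((t - R) ^ 2 / (t ^ 2 * R ^ 2)) := by
        field_simp
        ring
      have e2 : 8 / R ^ 6 * (t ^ 2 - R ^ 2) ^ 2 = 8 * ((t - R) ^ 2 * (t + R) ^ 2) / R ^ 6 := by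
        ring
      rw [e1, hw, one_mul, e2, div_le_div_iff₀ (by positivity) (by positivity)]
      have h1 : R ^ 2 ≤ (t + R) ^ 2 := by nlinarith
      have h2 : R ^ 2 ≤ 8 * t ^ 2 := by linarith
      calc (t - R) ^ 2 * R ^ 6 = (t - R) ^ 2 * R ^ 2 * (R ^ 2 * R ^ 2) := by ring
        _ ≤ (t - R) ^ 2 * R ^ 2 * ((t + R) ^ 2 * (8 * t ^ 2)) := by gcongr
        _ = _ := by ring
    calc (w ⬝ᵥ y - w ⬝ᵥ x / R) ^ 2 ≤ X ^ 2 * (8 / R ^ 6 * (578 * R ^ 2 * n)) := by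
          rw [e, hX]
          exact (dotProduct_sq_le _ _).trans
            (mul_le_mul_of_nonneg_left hz (dotProduct_self_nonneg_real x))
      _ = _ := by
          rw [← hT]
          field_simp
          ring
  have e : (w ⬝ᵥ y) ^ 2 - (w ⬝ᵥ x) ^ 2 / R ^ 2 =
      (w ⬝ᵥ y - w ⬝ᵥ x / R) * (w ⬝ᵥ y + w ⬝ᵥ x / R) := by ring
  rw [e, abs_mul]
  calc _ ≤ (68 * T / R ^ 2 * X) * (3 * T / R * X + T / R * X) :=
        mul_le_mul hPQ ((abs_add_le _ _).trans (add_le_add hP hQ)) (abs_nonneg _) (by positivity)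
    _ = _ := by
        rw [← hX, ← hT]
        field_simp
        ring

/-- The quadratic form of the normalized signed Laplacian, when the matrix and its entrywise
absolute value are spectrally close to matrices with the expected structure. -/
theorem abs_quadratic_form_sub_le {A M N : Matrix (Fin n) (Fin n) ℝ} {R θ p a b e : ℝ}
    {v : Fin n → ℝ} (hR : 1 ≤ R) (hp0 : 0 ≤ p) (hp1 : p ≤ 1) (hθ0 : 0 ≤ θ)
    (hθ : θ ^ 2 ≤ 288 * R ^ 2) (hdeg : ∀ i, R ^ 2 / 8 ≤ nodeDegree A i)
    (hA : ∀ y, ((A - M) *ᵥ y) ⬝ᵥ ((A - M) *ᵥ y) ≤ θ ^ 2 * (y ⬝ᵥ y))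
    (hB : ∀ y, ((A.map abs - N) *ᵥ y) ⬝ᵥ ((A.map abs - N) *ᵥ y) ≤ θ ^ 2 * (y ⬝ᵥ y))
    (hM : ∀ y, y ⬝ᵥ (M *ᵥ y) = a * (1 ⬝ᵥ y) ^ 2 + b * (v ⬝ᵥ y) ^ 2 - e * (y ⬝ᵥ y))
    (hv : ∀ i, v i ^ 2 = 1) (ha : |a| * n ≤ R ^ 2) (hb : |b| * n ≤ R ^ 2) (he : |e| ≤ 1)
    (hN : ∀ i, ∑ j, N i j = R ^ 2 - p) (x : Fin n → ℝ) :
    |x ⬝ᵥ (normalizedSignedLaplacian A *ᵥ x) -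
        (x ⬝ᵥ x - a / R ^ 2 * (1 ⬝ᵥ x) ^ 2 - b / R ^ 2 * (v ⬝ᵥ x) ^ 2)| ≤
      688 / R * (x ⬝ᵥ x) := by
  have hR0 : 0 < R := by linarith
  have hd0 : ∀ i, 0 < nodeDegree A i := fun i => lt_of_lt_of_le (by positivity) (hdeg i)
  have hxx := dotProduct_self_nonneg_real x
  rw [dotProduct_normalizedSignedLaplacian_mulVec hd0]
  have hsum : ∑ i, (nodeDegree A i - R ^ 2) ^ 2 ≤ 578 * R ^ 2 * n := by
    -- The image of the vector 1 has the entries dᵢ - R² + p; since p ≤ 1, removing p costs at most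
    -- 2 · 288 + 2 = 578.
    have h1 := hB 1
    have h2 : ∀ i, ((A.map abs - N) *ᵥ 1) i = nodeDegree A i - R ^ 2 + p := by
      intro i
      rw [sub_mulVec, Pi.sub_apply]
      simp only [mulVec, dotProduct, Pi.one_apply, mul_one, map_apply, hN, nodeDegree]
      ring
    simp only [dotProduct, h2, Pi.one_apply, mul_one, Finset.sum_const, Finset.card_univ,
      Fintype.card_fin, nsmul_eq_mul] at h1
    have h3 : ∀ i, (nodeDegree A i - R ^ 2) ^ 2 ≤
        2 * ((nodeDegree A i - R ^ 2 + p) * (nodeDegree A i - R ^ 2 + p)) + 2 := by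
      intro i
      nlinarith [sq_nonneg (nodeDegree A i - R ^ 2 + p + p)]
    refine (Finset.sum_le_sum fun i _ => h3 i).trans ?_
    rw [Finset.sum_add_distrib, ← Finset.mul_sum]
    simp only [Finset.sum_const, Finset.card_univ, Fintype.card_fin, nsmul_eq_mul]
    have hn : (0 : ℝ) ≤ n := Nat.cast_nonneg n
    have hR2 : 1 ≤ R ^ 2 := one_le_pow₀ hR
    nlinarith
  set y : Fin n → ℝ := fun i => x i / √(nodeDegree A i) with hy
  have hyy : y ⬝ᵥ y ≤ 8 / R ^ 2 * (x ⬝ᵥ x) := by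
    rw [dotProduct, dotProduct, Finset.mul_sum]
    refine Finset.sum_le_sum fun i _ => ?_
    have e : y i * y i = x i * x i / nodeDegree A i := by
      rw [hy]
      simp only
      rw [div_mul_div_comm, Real.mul_self_sqrt (hd0 i).le]
    rw [e, div_mul_eq_mul_div, div_le_div_iff₀ (hd0 i) (by positivity)]
    nlinarith [mul_le_mul_of_nonneg_left (hdeg i) (mul_self_nonneg (x i))]
  have hy0 := dotProduct_self_nonneg_real y
  have hθR : θ ≤ 17 * R := abs_le_of_sq_le_sq' (by nlinarith) (by positivity) |>.2
  have t1 : |y ⬝ᵥ ((A - M) *ᵥ y)| ≤ 136 / R * (x ⬝ᵥ x) := by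
    have h1 : |y ⬝ᵥ ((A - M) *ᵥ y)| ≤ θ * (y ⬝ᵥ y) := by
      refine abs_le_of_sq_le_sq ?_ (by positivity)
      calc _ ≤ _ := dotProduct_sq_le _ _
        _ ≤ (y ⬝ᵥ y) * (θ ^ 2 * (y ⬝ᵥ y)) := by gcongr; exact hA y
        _ = _ := by ring
    calc _ ≤ _ := h1
      _ ≤ 17 * R * (8 / R ^ 2 * (x ⬝ᵥ x)) := by gcongr
      _ = _ := by field_simp; ring
  have t2 : |e * (y ⬝ᵥ y)| ≤ 8 / R * (x ⬝ᵥ x) := by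
    rw [abs_mul, abs_of_nonneg hy0]
    calc |e| * (y ⬝ᵥ y) ≤ 1 * (8 / R ^ 2 * (x ⬝ᵥ x)) := by gcongr
      _ ≤ 8 / R * (x ⬝ᵥ x) := by
        rw [one_mul]
        gcongr
        nlinarith
  have t3 : ∀ (w : Fin n → ℝ) (f : ℝ), (∀ i, w i ^ 2 = 1) → |f| * n ≤ R ^ 2 →
      |f * (w ⬝ᵥ y) ^ 2 - f / R ^ 2 * (w ⬝ᵥ x) ^ 2| ≤ 272 / R * (x ⬝ᵥ x) := by
    intro w f hw hf
    have h1 := abs_sq_dotProduct_sub_le hR0 hdeg hsum hw x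
    have e1 : f * (w ⬝ᵥ y) ^ 2 - f / R ^ 2 * (w ⬝ᵥ x) ^ 2 =
        f * ((w ⬝ᵥ y) ^ 2 - (w ⬝ᵥ x) ^ 2 / R ^ 2) := by ring
    rw [e1, abs_mul]
    calc _ ≤ |f| * (272 * n / R ^ 3 * (x ⬝ᵥ x)) := by gcongr
      _ = 272 / R ^ 3 * (x ⬝ᵥ x) * (|f| * n) := by ring
      _ ≤ 272 / R ^ 3 * (x ⬝ᵥ x) * R ^ 2 := by gcongr
      _ = _ := by field_simp
  have e1 : y ⬝ᵥ (A *ᵥ y) = y ⬝ᵥ ((A - M) *ᵥ y) + y ⬝ᵥ (M *ᵥ y) := by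
    rw [sub_mulVec, dotProduct_sub]; ring
  rw [e1, hM y]
  have t4 := t3 1 a (fun i => by simp) ha
  have t5 := t3 v b hv hb
  -- Contributions of the noise (17 · 8), of the multiple of the identity, and of the two rank one
  -- terms.
  have e3 : 688 / R * (x ⬝ᵥ x) = 136 / R * (x ⬝ᵥ x) + 8 / R * (x ⬝ᵥ x) +
      272 / R * (x ⬝ᵥ x) + 272 / R * (x ⬝ᵥ x) := by ring
  rw [e3]
  rw [abs_le] at *
  constructor <;> linarith

theorem isHermitian_normalizedSignedLaplacian {A : Matrix (Fin n) (Fin n) ℝ} (hA : Aᵀ = A) :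
    (normalizedSignedLaplacian A).IsHermitian := by
  have : (normalizedSignedLaplacian A)ᵀ = normalizedSignedLaplacian A := by
    simp only [normalizedSignedLaplacian, signedLaplacian, invSqrtDegree, transpose_mul,
      transpose_sub, diagonal_transpose, hA, mul_assoc]
  rw [IsHermitian, conjTranspose_eq_transpose_of_trivial, this]

end Deterministic

/-! ### Moments of a single entry. -/

section EntryMoments

/-- The law of the presence and the sign of an edge. -/
noncomputable def entryLaw (p s : unitInterval) : Measure (Bool × Bool) :=
  (bernoulliMeasure true false p).prod (bernoulliMeasure true false s)

instance (p s : unitInterval) : IsProbabilityMeasure (entryLaw p s) := by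
  unfold entryLaw; infer_instance

theorem integral_entryLaw (p s : unitInterval) (f : Bool × Bool → ℝ) :
    ∫ b, f b ∂entryLaw p s = p * (s * f (true, true) + (1 - s) * f (true, false)) +
      (1 - p) * (s * f (false, true) + (1 - s) * f (false, false)) := by
  rw [entryLaw, integral_prod _ Integrable.of_finite]
  simp only [integral_bernoulliMeasure, smul_eq_mul]

theorem integral_signedEntry_centered (p s : unitInterval) :
    ∫ b, (signedEntry b - p * (1 - 2 * s)) / 2 ∂entryLaw p s = 0 := by
  rw [integral_entryLaw]; simp [signedEntry]; ring

theorem abs_signedEntry_centered_le (p s : unitInterval) (b : Bool × Bool) :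
    |(signedEntry b - p * (1 - 2 * s)) / 2| ≤ 1 := by
  have hp := p.2.1
  have hp' := p.2.2
  have hs := s.2.1
  have hs' := s.2.2
  have h1 : |(p : ℝ) * (1 - 2 * s)| ≤ 1 := by
    rw [abs_mul, abs_of_nonneg hp]
    have : |1 - 2 * (s : ℝ)| ≤ 1 := abs_le.2 ⟨by linarith, by linarith⟩
    nlinarith [abs_nonneg (1 - 2 * (s : ℝ))]
  have h2 : |signedEntry b| ≤ 1 := by
    unfold signedEntry; split_ifs <;> simp
  rw [abs_le] at *
  constructor <;> linarith

theorem integral_sq_signedEntry_centered_le (p s : unitInterval) :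
    ∫ b, ((signedEntry b - p * (1 - 2 * s)) / 2) ^ 2 ∂entryLaw p s ≤ (p : ℝ) := by
  rw [integral_entryLaw]
  have hp := p.2.1
  simp only [signedEntry, if_true, Bool.false_eq_true, if_false]
  nlinarith [sq_nonneg ((p : ℝ) * (1 - 2 * s))]

theorem integral_abs_signedEntry_centered (p s : unitInterval) :
    ∫ b, (|signedEntry b| - p) / 2 ∂entryLaw p s = 0 := by
  rw [integral_entryLaw]; simp [signedEntry]; ring

theorem abs_abs_signedEntry_centered_le (p : unitInterval) (b : Bool × Bool) :
    |(|signedEntry b| - p) / 2| ≤ 1 := by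
  have hp := p.2.1
  have hp' := p.2.2
  have h2 : |signedEntry b| ≤ 1 := by
    unfold signedEntry; split_ifs <;> simp
  have := abs_nonneg (signedEntry b)
  exact abs_le.2 ⟨by linarith, by linarith⟩

theorem integral_sq_abs_signedEntry_centered_le (p s : unitInterval) :
    ∫ b, ((|signedEntry b| - p) / 2) ^ 2 ∂entryLaw p s ≤ (p : ℝ) := by
  rw [integral_entryLaw]
  have hp := p.2.1
  simp only [signedEntry, if_true, Bool.false_eq_true, if_false, abs_neg, abs_one, abs_zero]
  nlinarith [sq_nonneg (p : ℝ)]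

/-- The integral is 1 - p(1 - 1/e) ≤ 1 - p/2 ≤ exp(-p/2). -/
theorem integral_exp_neg_abs_signedEntry_le (p s : unitInterval) :
    ∫ b, Real.exp (-|signedEntry b|) ∂entryLaw p s ≤ Real.exp (-(p / 2)) := by
  rw [integral_entryLaw]
  have hp := p.2.1
  simp only [signedEntry, if_true, Bool.false_eq_true, if_false, abs_neg, abs_one, abs_zero,
    neg_zero, Real.exp_zero]
  have h1 := Real.add_one_le_exp (-((p : ℝ) / 2))
  have h2 : Real.exp (-1) ≤ 1 / 2 := by
    rw [Real.exp_neg, one_div]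
    have := Real.exp_one_gt_d9
    exact inv_anti₀ (by norm_num) (by linarith)
  nlinarith

end EntryMoments

/-! ### Concentration of the adjacency matrices and lower bound for the degrees. -/

section Concentration

open Matrix

variable {n : ℕ} (P S : Matrix (Fin n) (Fin n) unitInterval)

/-- The law of the presence and signs of all edges. -/
noncomputable def edgeLaw : Measure (NodePair n → Bool × Bool) :=
  Measure.pi fun e : NodePair n => entryLaw (P e.1.1 e.1.2) (S e.1.1 e.1.2)

instance : IsProbabilityMeasure (edgeLaw P S) := by
  unfold edgeLaw; infer_instance

theorem signedErdosRenyi_eq : signedErdosRenyi P S = (edgeLaw P S).map signedAdjacency := rfl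

/-- The expected signed adjacency matrix. -/
noncomputable def meanAdjacency : Matrix (Fin n) (Fin n) ℝ :=
  symmMatrix fun e => (P e.1.1 e.1.2 : ℝ) * (1 - 2 * (S e.1.1 e.1.2 : ℝ))

/-- The matrix of edge probabilities. -/
noncomputable def meanAbsAdjacency : Matrix (Fin n) (Fin n) ℝ :=
  symmMatrix fun e => (P e.1.1 e.1.2 : ℝ)

theorem signedAdjacency_eq (x : NodePair n → Bool × Bool) :
    signedAdjacency x = symmMatrix fun e => signedEntry (x e) := rfl

theorem map_abs_symmMatrix (f : NodePair n → ℝ) :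
    (symmMatrix f).map abs = symmMatrix fun e => |f e| := by
  ext i j
  simp only [symmMatrix, map_apply, of_apply]
  split_ifs <;> simp

/-- Halving keeps the centered entries within [-1, 1]; for this reason `6 * r` becomes `12 * r`
below. -/
theorem symmMatrix_sub_eq (f g : NodePair n → ℝ) :
    symmMatrix f - symmMatrix g = (2 : ℝ) • symmMatrix fun e => (f e - g e) / 2 := by
  ext i j
  simp only [symmMatrix, Matrix.sub_apply, Matrix.smul_apply, of_apply, smul_eq_mul]
  split_ifs <;> ring

variable {P S}

theorem measureReal_adjacency_tail_le {c r : ℝ} {j : ℕ} (hP : ∀ i j, (P i j : ℝ) ≤ c)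
    (hc0 : 0 ≤ c) (hc1 : c ≤ 1) (hn : 0 < n) (hr : ((2 ^ (j + 1) : ℕ) + 1 : ℝ) ^ 2 ≤ r)
    (hc : c * n = r ^ 2) :
    (edgeLaw P S).real {x | ¬ ∀ y : Fin n → ℝ,
      ((signedAdjacency x - meanAdjacency P S) *ᵥ y) ⬝ᵥ
        ((signedAdjacency x - meanAdjacency P S) *ᵥ y) ≤ (12 * r) ^ 2 * (y ⬝ᵥ y)} ≤
      n / 2 ^ 2 ^ (j + 1) := by
  have := measureReal_spectral_tail_le hc0 hc1
    (fun e : NodePair n => integral_signedEntry_centered (P e.1.1 e.1.2) (S e.1.1 e.1.2))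
    (fun e => abs_signedEntry_centered_le (P e.1.1 e.1.2) (S e.1.1 e.1.2))
    (fun e => (integral_sq_signedEntry_centered_le (P e.1.1 e.1.2) (S e.1.1 e.1.2)).trans
      (hP _ _)) hn hr hc
  refine le_trans (measureReal_mono ?_) this
  intro x hx hy
  refine hx fun y => ?_
  have h := hy y
  rw [signedAdjacency_eq, meanAdjacency, symmMatrix_sub_eq, smul_mulVec, smul_dotProduct,
    dotProduct_smul, smul_eq_mul, smul_eq_mul]
  linarith

theorem measureReal_abs_adjacency_tail_le {c r : ℝ} {j : ℕ} (hP : ∀ i j, (P i j : ℝ) ≤ c)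
    (hc0 : 0 ≤ c) (hc1 : c ≤ 1) (hn : 0 < n) (hr : ((2 ^ (j + 1) : ℕ) + 1 : ℝ) ^ 2 ≤ r)
    (hc : c * n = r ^ 2) :
    (edgeLaw P S).real {x | ¬ ∀ y : Fin n → ℝ,
      (((signedAdjacency x).map abs - meanAbsAdjacency P) *ᵥ y) ⬝ᵥ
        (((signedAdjacency x).map abs - meanAbsAdjacency P) *ᵥ y) ≤ (12 * r) ^ 2 * (y ⬝ᵥ y)} ≤
      n / 2 ^ 2 ^ (j + 1) := by
  have := measureReal_spectral_tail_le hc0 hc1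
    (fun e : NodePair n => integral_abs_signedEntry_centered (P e.1.1 e.1.2) (S e.1.1 e.1.2))
    (fun e => abs_abs_signedEntry_centered_le (P e.1.1 e.1.2))
    (fun e => (integral_sq_abs_signedEntry_centered_le (P e.1.1 e.1.2) (S e.1.1 e.1.2)).trans
      (hP _ _)) hn hr hc
  refine le_trans (measureReal_mono ?_) this
  intro x hx hy
  refine hx fun y => ?_
  have h := hy y
  rw [signedAdjacency_eq, map_abs_symmMatrix, meanAbsAdjacency, symmMatrix_sub_eq, smul_mulVec,
    smul_dotProduct, dotProduct_smul, smul_eq_mul, smul_eq_mul]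
  linarith

theorem integral_exp_neg_nodeDegree_le (i : Fin n) :
    ∫ x, Real.exp (-nodeDegree (signedAdjacency x) i) ∂edgeLaw P S ≤
      Real.exp (-((∑ j, meanAbsAdjacency P i j) / 2)) := by
  have h1 : ∀ x : NodePair n → Bool × Bool, Real.exp (-nodeDegree (signedAdjacency x) i) =
      ∏ e : NodePair n, Real.exp (-if e.1.1 = i ∨ e.1.2 = i then |signedEntry (x e)| else 0) := by
    intro x
    rw [← Real.exp_sum, Finset.sum_neg_distrib, ← sum_symmMatrix_row, ← map_abs_symmMatrix]
    rfl
  simp_rw [h1]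
  rw [edgeLaw, integral_fintype_prod_eq_prod
    (fun (e : NodePair n) b => Real.exp (-if e.1.1 = i ∨ e.1.2 = i then |signedEntry b| else 0)),
    meanAbsAdjacency, sum_symmMatrix_row, Finset.sum_div, ← Finset.sum_neg_distrib, Real.exp_sum]
  refine Finset.prod_le_prod (fun e _ => integral_nonneg fun b => (Real.exp_pos _).le)
    fun e _ => ?_
  split_ifs
  · exact integral_exp_neg_abs_signedEntry_le _ _
  · simp

theorem measureReal_nodeDegree_lt_le {t : ℝ} (ht : ∀ i, 4 * t ≤ ∑ j, meanAbsAdjacency P i j) :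
    (edgeLaw P S).real {x | ¬ ∀ i, t ≤ nodeDegree (signedAdjacency x) i} ≤
      n * Real.exp (-t) := by
  have hsub : {x | ¬ ∀ i, t ≤ nodeDegree (signedAdjacency x) i} ⊆
      ⋃ i : Fin n, {x | Real.exp (-t) ≤ Real.exp (-nodeDegree (signedAdjacency x) i)} := by
    intro x hx
    simp only [Set.mem_ofPred_eq, not_forall, not_le] at hx
    obtain ⟨i, hi⟩ := hx
    exact Set.mem_iUnion.2 ⟨i, Real.exp_le_exp.2 (by linarith)⟩
  refine (measureReal_mono hsub).trans ((measureReal_iUnion_fintype_le _).trans ?_)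
  have : ∀ i : Fin n, (edgeLaw P S).real
      {x | Real.exp (-t) ≤ Real.exp (-nodeDegree (signedAdjacency x) i)} ≤ Real.exp (-t) := by
    intro i
    have hm := mul_meas_ge_le_integral_of_nonneg (μ := edgeLaw P S)
      (f := fun x => Real.exp (-nodeDegree (signedAdjacency x) i))
      (Filter.Eventually.of_forall fun x => (Real.exp_pos _).le) Integrable.of_finite
      (Real.exp (-t))
    -- The mean degree is at least 4t, so the exponential moment is at most exp(-2t), and Markov's
    -- inequality loses one factor exp(-t).
    have h2 : Real.exp (-((∑ j, meanAbsAdjacency P i j) / 2)) ≤ Real.exp (-t) * Real.exp (-t) := by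
      rw [← Real.exp_add]
      exact Real.exp_le_exp.2 (by linarith [ht i])
    exact le_of_mul_le_mul_left (hm.trans ((integral_exp_neg_nodeDegree_le i).trans h2))
      (Real.exp_pos _)
  refine (Finset.sum_le_sum fun i _ => this i).trans ?_
  simp

end Concentration

/-! ### The mean matrices of the bisection model. -/

section Block

open Matrix

/-- The vector which is `1` on the first and `-1` on the second half of the nodes. -/
def sideVector (k : ℕ) (i : Fin (2 * k)) : ℝ := if i.val < k then 1 else -1

theorem sideVector_sq (k : ℕ) (i : Fin (2 * k)) : sideVector k i ^ 2 = 1 := by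
  unfold sideVector; split_ifs <;> norm_num

theorem sum_sideVector (k : ℕ) : ∑ i, sideVector k i = 0 := by
  have := Fin.sum_univ_eq_sum_range (fun m : ℕ => if m < k then (1 : ℝ) else -1) (2 * k)
  unfold sideVector
  rw [this, two_mul, Finset.sum_range_add]
  have h1 : ∀ x ∈ Finset.range k, (if x < k then (1 : ℝ) else -1) = 1 := fun x hx =>
    if_pos (Finset.mem_range.1 hx)
  rw [Finset.sum_congr rfl h1]
  simp

variable {k : ℕ} (p q s : unitInterval)

/-- The edge probabilities of the signed stochastic bisection model. -/
abbrev blockProb (k : ℕ) (p q : unitInterval) : Matrix (Fin (2 * k)) (Fin (2 * k)) unitInterval :=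
  blockExtend (bisection k) !![p, q; q, p]

theorem meanAbsAdjacency_block (i j : Fin (2 * k)) :
    meanAbsAdjacency (blockProb k p q) i j =
      ((p : ℝ) + q) / 2 + ((p : ℝ) - q) / 2 * (sideVector k i * sideVector k j) -
        if i = j then (p : ℝ) else 0 := by
  rcases lt_trichotomy i j with h | h | h
  · rw [meanAbsAdjacency, symmMatrix_of_lt _ h]
    by_cases hi : i.val < k <;> by_cases hj : j.val < k <;>
      simp [blockExtend, bisection, sideVector, h.ne, hi, hj] <;> ring
  · subst h
    have := sideVector_sq k i
    rw [meanAbsAdjacency, symmMatrix_self, ← sq, this, if_pos rfl]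
    ring
  · rw [meanAbsAdjacency, symmMatrix_comm, symmMatrix_of_lt _ h]
    by_cases hi : i.val < k <;> by_cases hj : j.val < k <;>
      simp [blockExtend, bisection, sideVector, h.ne, h.ne', hi, hj] <;> ring

/-- The signs turn the probabilities p and q into the means (1-2s)p and -(1-2s)q, so half sum and
half difference exchange roles compared with `meanAbsAdjacency_block`. -/
theorem meanAdjacency_block (i j : Fin (2 * k)) :
    meanAdjacency (blockProb k p q) (blockProb k s (unitInterval.symm s)) i j =
      (1 - 2 * (s : ℝ)) * (((p : ℝ) - q) / 2 +
        ((p : ℝ) + q) / 2 * (sideVector k i * sideVector k j) -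
          if i = j then (p : ℝ) else 0) := by
  rcases lt_trichotomy i j with h | h | h
  · rw [meanAdjacency, symmMatrix_of_lt _ h]
    by_cases hi : i.val < k <;> by_cases hj : j.val < k <;>
      simp [blockExtend, bisection, sideVector, h.ne, hi, hj] <;> ring
  · subst h
    have := sideVector_sq k i
    rw [meanAdjacency, symmMatrix_self, ← sq, this, if_pos rfl]
    ring
  · rw [meanAdjacency, symmMatrix_comm, symmMatrix_of_lt _ h]
    by_cases hi : i.val < k <;> by_cases hj : j.val < k <;>
      simp [blockExtend, bisection, sideVector, h.ne, h.ne', hi, hj] <;> ring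

theorem sum_meanAbsAdjacency_block (i : Fin (2 * k)) :
    ∑ j, meanAbsAdjacency (blockProb k p q) i j = k * ((p : ℝ) + q) - p := by
  simp only [meanAbsAdjacency_block, Finset.sum_sub_distrib, Finset.sum_add_distrib,
    ← Finset.mul_sum, sum_sideVector]
  simp
  ring

theorem dotProduct_meanAdjacency_block (y : Fin (2 * k) → ℝ) :
    y ⬝ᵥ (meanAdjacency (blockProb k p q) (blockProb k s (unitInterval.symm s)) *ᵥ y) =
      (1 - 2 * (s : ℝ)) * (((p : ℝ) - q) / 2) * (1 ⬝ᵥ y) ^ 2 +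
      (1 - 2 * (s : ℝ)) * (((p : ℝ) + q) / 2) * (sideVector k ⬝ᵥ y) ^ 2 -
      (1 - 2 * (s : ℝ)) * p * (y ⬝ᵥ y) := by
  have h : ∀ i, (meanAdjacency (blockProb k p q) (blockProb k s (unitInterval.symm s)) *ᵥ y) i =
      (1 - 2 * (s : ℝ)) * (((p : ℝ) - q) / 2) * (1 ⬝ᵥ y) +
      (1 - 2 * (s : ℝ)) * (((p : ℝ) + q) / 2) * (sideVector k ⬝ᵥ y) * sideVector k i -
      (1 - 2 * (s : ℝ)) * p * y i := by
    intro i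
    have e : ∀ j, meanAdjacency (blockProb k p q) (blockProb k s (unitInterval.symm s)) i j * y j =
        (1 - 2 * (s : ℝ)) * (((p : ℝ) - q) / 2) * y j +
        (1 - 2 * (s : ℝ)) * (((p : ℝ) + q) / 2) * sideVector k i * (sideVector k j * y j) -
        if i = j then (1 - 2 * (s : ℝ)) * p * y j else 0 := by
      intro j
      rw [meanAdjacency_block]
      split_ifs <;> ring
    simp only [mulVec, dotProduct, e, Finset.sum_sub_distrib, Finset.sum_add_distrib,
      ← Finset.mul_sum, Finset.sum_ite_eq, Finset.mem_univ, if_true, Pi.one_apply, one_mul]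
    ring
  have e : ∀ i, y i * (meanAdjacency (blockProb k p q)
      (blockProb k s (unitInterval.symm s)) *ᵥ y) i =
      (1 - 2 * (s : ℝ)) * (((p : ℝ) - q) / 2) * (1 ⬝ᵥ y) * y i +
      (1 - 2 * (s : ℝ)) * (((p : ℝ) + q) / 2) * (sideVector k ⬝ᵥ y) * (sideVector k i * y i) -
      (1 - 2 * (s : ℝ)) * p * (y i * y i) := by
    intro i; rw [h]; ring
  rw [dotProduct]
  simp only [e, Finset.sum_sub_distrib, Finset.sum_add_distrib, ← Finset.mul_sum]
  simp only [dotProduct, Pi.one_apply, one_mul]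
  ring

theorem transpose_signedAdjacency {n : ℕ} (x : NodePair n → Bool × Bool) :
    (signedAdjacency x)ᵀ = signedAdjacency x := by
  ext i j
  exact symmMatrix_comm (fun e => signedEntry (x e)) j i

/-- The eigenvalues of the normalized signed Laplacian of the signed stochastic bisection model
in the event that the matrices and the degrees are concentrated. -/
theorem eigval_block_of_concentration (hk : 1 ≤ k) {p q s : unitInterval} (hqp : (q : ℝ) ≤ p)
    (hs : (s : ℝ) ≤ 1 / 2) {R θ : ℝ} (hR : 1 ≤ R) (hRk : R ^ 2 = k * ((p : ℝ) + q)) (hθ0 : 0 ≤ θ)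
    (hθ : θ ^ 2 ≤ 288 * R ^ 2) {x : NodePair (2 * k) → Bool × Bool}
    (hdeg : ∀ i, R ^ 2 / 8 ≤ nodeDegree (signedAdjacency x) i)
    (hA : ∀ y : Fin (2 * k) → ℝ,
      ((signedAdjacency x - meanAdjacency (blockProb k p q)
        (blockProb k s (unitInterval.symm s))) *ᵥ y) ⬝ᵥ
        ((signedAdjacency x - meanAdjacency (blockProb k p q)
          (blockProb k s (unitInterval.symm s))) *ᵥ y) ≤ θ ^ 2 * (y ⬝ᵥ y))
    (hB : ∀ y : Fin (2 * k) → ℝ,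
      (((signedAdjacency x).map abs - meanAbsAdjacency (blockProb k p q)) *ᵥ y) ⬝ᵥ
        (((signedAdjacency x).map abs - meanAbsAdjacency (blockProb k p q)) *ᵥ y) ≤
          θ ^ 2 * (y ⬝ᵥ y)) :
    |eigval (normalizedSignedLaplacian (signedAdjacency x)) 1 - 2 * (s : ℝ)| ≤ 688 / R ∧
    |eigval (normalizedSignedLaplacian (signedAdjacency x)) 2 -
      (1 - (1 - 2 * (s : ℝ)) * (((p : ℝ) - q) / ((p : ℝ) + q)))| ≤ 688 / R ∧
    ∀ l : ℕ, 2 < l → l ≤ 2 * k →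
      |eigval (normalizedSignedLaplacian (signedAdjacency x)) l - 1| ≤ 688 / R := by
  have hp0 := p.2.1
  have hp1 := p.2.2
  have hq0 := q.2.1
  have hs0 := s.2.1
  have hk0 : (0 : ℝ) < k := by exact_mod_cast hk
  have hR2 : 0 < R ^ 2 := by positivity
  have hpq : 0 < (p : ℝ) + q := by
    by_contra h
    nlinarith
  have key := abs_quadratic_form_sub_le (v := sideVector k) hR hp0 hp1 hθ0 hθ hdeg hA hB
    (dotProduct_meanAdjacency_block p q s) (sideVector_sq k)
    (by
      rw [abs_of_nonneg (by apply mul_nonneg <;> linarith), hRk]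
      push_cast
      have : (1 - 2 * (s : ℝ)) * ((p : ℝ) - q) ≤ (p : ℝ) + q := by nlinarith
      nlinarith)
    (by
      rw [abs_of_nonneg (by apply mul_nonneg <;> linarith), hRk]
      push_cast
      have : (1 - 2 * (s : ℝ)) * ((p : ℝ) + q) ≤ (p : ℝ) + q := by nlinarith
      nlinarith)
    (by
      rw [abs_of_nonneg (by apply mul_nonneg <;> linarith)]
      nlinarith)
    (fun i => by rw [sum_meanAbsAdjacency_block, hRk])
  have h11 : (1 : Fin (2 * k) → ℝ) ⬝ᵥ 1 = ((2 * k : ℕ) : ℝ) := by simp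
  have hvv : sideVector k ⬝ᵥ sideVector k = ((2 * k : ℕ) : ℝ) := by
    simp only [dotProduct, ← sq, sideVector_sq]; simp
  have h1v : (1 : Fin (2 * k) → ℝ) ⬝ᵥ sideVector k = 0 := by
    simp [dotProduct, sum_sideVector]
  have hα : (1 - 2 * (s : ℝ)) * (((p : ℝ) - q) / 2) / R ^ 2 =
      (1 - 2 * (s : ℝ)) * (((p : ℝ) - q) / ((p : ℝ) + q)) / ((2 * k : ℕ) : ℝ) := by
    rw [hRk]; push_cast; field_simp
  have hβ : (1 - 2 * (s : ℝ)) * (((p : ℝ) + q) / 2) / R ^ 2 =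
      (1 - 2 * (s : ℝ)) / ((2 * k : ℕ) : ℝ) := by
    rw [hRk]; push_cast; field_simp
  rw [hα, hβ] at key
  have hle : ((p : ℝ) - q) / ((p : ℝ) + q) ≤ 1 := by rw [div_le_one hpq]; linarith
  have h := eigval_of_quadratic_form_approx
    (isHermitian_normalizedSignedLaplacian (transpose_signedAdjacency x)) (by omega) h11 hvv h1v
    (mul_nonneg (by linarith) (div_nonneg (by linarith) hpq.le))
    (mul_le_of_le_one_right (by linarith) hle) key
  refine ⟨?_, h.2⟩
  convert h.1 using 3
  ring

end Block

/-! ### Transfer from the edge variables to an arbitrary random matrix. -/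

section Law

/-- A lower bound for the probability that a random matrix with the law `signedErdosRenyi P S` has
a property, in terms of an event for the edge variables. -/
theorem one_sub_le_measureReal_of_hasLaw {n : ℕ} {P S : Matrix (Fin n) (Fin n) unitInterval}
    {Ω : Type*} [MeasurableSpace Ω] {μ : Measure Ω} [IsProbabilityMeasure μ]
    {A : Ω → Matrix (Fin n) (Fin n) ℝ} (hA : HasLaw A (signedErdosRenyi P S) μ)
    {Q : Matrix (Fin n) (Fin n) ℝ → Prop} {bad : Set (NodePair n → Bool × Bool)}
    (h : ∀ x, x ∉ bad → Q (signedAdjacency x)) :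
    1 - (edgeLaw P S).real bad ≤ μ.real {ω | Q (A ω)} := by
  have : MeasurableSingletonClass (Matrix (Fin n) (Fin n) ℝ) :=
    inferInstanceAs (MeasurableSingletonClass (Fin n → Fin n → ℝ))
  -- The good outcomes have a finite, hence measurable, image; measurability of `Q` is not needed.
  have hG : MeasurableSet (signedAdjacency '' badᶜ) := (Set.toFinite _).measurableSet
  have h1 : μ.real {ω | A ω ∈ signedAdjacency '' badᶜ} =
      (edgeLaw P S).real (signedAdjacency ⁻¹' (signedAdjacency '' badᶜ)) := by
    rw [measureReal_def, measureReal_def]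
    congr 1
    rw [hA.measure_eq (p := fun M => M ∈ signedAdjacency '' badᶜ) hG, signedErdosRenyi_eq]
    exact Measure.map_apply (measurable_of_finite _) hG
  calc 1 - (edgeLaw P S).real bad = (edgeLaw P S).real badᶜ :=
        (probReal_compl_eq_one_sub (Set.toFinite bad).measurableSet).symm
    _ ≤ (edgeLaw P S).real (signedAdjacency ⁻¹' (signedAdjacency '' badᶜ)) :=
        measureReal_mono (Set.subset_preimage_image _ _)
    _ = _ := h1.symm
    _ ≤ _ := by
        refine measureReal_mono ?_
        rintro ω ⟨x, hx, hxA⟩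
        exact (hxA ▸ h x hx : Q (A ω))

theorem one_sub_add_le_measureReal_of_hasLaw {n : ℕ} {P S : Matrix (Fin n) (Fin n) unitInterval}
    {Ω : Type*} [MeasurableSpace Ω] {μ : Measure Ω} [IsProbabilityMeasure μ]
    {A : Ω → Matrix (Fin n) (Fin n) ℝ} (hA : HasLaw A (signedErdosRenyi P S) μ)
    {E₁ E₂ E₃ : (NodePair n → Bool × Bool) → Prop} {a₁ a₂ a₃ : ℝ}
    (h₁ : (edgeLaw P S).real {x | ¬ E₁ x} ≤ a₁) (h₂ : (edgeLaw P S).real {x | ¬ E₂ x} ≤ a₂)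
    (h₃ : (edgeLaw P S).real {x | ¬ E₃ x} ≤ a₃) {Q : Matrix (Fin n) (Fin n) ℝ → Prop}
    (h : ∀ x, E₁ x → E₂ x → E₃ x → Q (signedAdjacency x)) :
    1 - (a₁ + (a₂ + a₃)) ≤ μ.real {ω | Q (A ω)} := by
  refine le_trans (sub_le_sub_left ?_ 1) (one_sub_le_measureReal_of_hasLaw hA (Q := Q)
    (bad := {x | ¬ E₁ x} ∪ ({x | ¬ E₂ x} ∪ {x | ¬ E₃ x})) fun x hx => ?_)
  · exact (measureReal_union_le _ _).trans
      (add_le_add h₁ ((measureReal_union_le _ _).trans (add_le_add h₂ h₃)))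
  · simp only [Set.mem_union, not_or, Set.mem_ofPred_eq, not_not] at hx
    exact h x hx.1 hx.2.1 hx.2.2

end Law

/-! ### Choice of the exponent and growth comparisons. -/

section Asymptotics

open Filter

theorem eventually_log_le_rpow (a b : ℝ) {c s : ℝ} (hc : 0 < c) (hs : 0 < s) :
    ∀ᶠ k : ℕ in atTop, a * Real.log k + b ≤ c * (k : ℝ) ^ s := by
  have h1 : (fun x : ℝ => a * Real.log x + b) =o[atTop] fun x : ℝ => x ^ s := by
    refine ((isLittleO_log_rpow_atTop hs).const_mul_left a).add ?_
    exact Asymptotics.isLittleO_const_left.2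
      (Or.inr (tendsto_norm_atTop_atTop.comp (tendsto_rpow_atTop hs)))
  have h2 := tendsto_natCast_atTop_atTop.eventually (h1.bound hc)
  filter_upwards [h2] with k hk
  rw [Real.norm_of_nonneg (Real.rpow_nonneg (Nat.cast_nonneg k) s)] at hk
  exact (Real.le_norm_self _).trans hk

theorem exists_two_pow_two_pow_ge {k : ℕ} (hk : 1 ≤ k) :
    ∃ j : ℕ, 8 * (k : ℝ) ^ 3 ≤ 2 ^ 2 ^ (j + 1) ∧
      ((2 ^ (j + 1) : ℕ) : ℝ) + 1 ≤ 12 * Real.log k + 13 := by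
  set m := Nat.log 2 k with hm
  -- As k < 2^(m+1), 8k³ ≤ 2^(3m+6). Rounding `x` up to a power of two less than doubles it, and
  -- 6/log 2 ≤ 12.
  set x := 3 * m + 6 with hx
  have hc1 : 1 ≤ Nat.clog 2 x := Nat.clog_pos one_lt_two (by omega)
  refine ⟨Nat.clog 2 x - 1, ?_, ?_⟩
  · rw [Nat.sub_add_cancel hc1]
    have h1 : k < 2 ^ (m + 1) := Nat.lt_pow_succ_log_self one_lt_two k
    have h2 : x ≤ 2 ^ Nat.clog 2 x := Nat.le_pow_clog one_lt_two x
    have h3 : 8 * k ^ 3 ≤ 2 ^ 2 ^ Nat.clog 2 x :=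
      calc 8 * k ^ 3 ≤ 8 * (2 ^ (m + 1)) ^ 3 := by gcongr
        _ = 2 ^ x := by rw [hx]; ring
        _ ≤ _ := Nat.pow_le_pow_right (by norm_num) h2
    exact_mod_cast h3
  · have h1 : 2 ^ (Nat.clog 2 x - 1 + 1) ≤ 2 * x := by
      have := Nat.pow_pred_clog_lt_self one_lt_two (x := x) (by omega)
      rw [Nat.pred_eq_sub_one] at this
      rw [pow_succ]
      omega
    have h2 : ((2 ^ (Nat.clog 2 x - 1 + 1) : ℕ) : ℝ) ≤ 6 * m + 12 := by
      calc _ ≤ ((2 * x : ℕ) : ℝ) := by exact_mod_cast h1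
        _ = _ := by rw [hx]; push_cast; ring
    have h3 : ((2 ^ m : ℕ) : ℝ) ≤ k := by exact_mod_cast Nat.pow_log_le_self 2 (by omega)
    have h4 := Real.log_le_log (by positivity) h3
    rw [Nat.cast_pow, Real.log_pow, Nat.cast_ofNat] at h4
    have h5 := Real.log_two_gt_d9
    have h6 : (0 : ℝ) ≤ m := Nat.cast_nonneg m
    nlinarith

end Asymptotics

/-! ### Assembly of the probability bounds. -/

theorem blockProb_le {k : ℕ} {p q : unitInterval} (hqp : (q : ℝ) ≤ p) (i j : Fin (2 * k)) :
    (blockProb k p q i j : ℝ) ≤ p := by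
  have hp := p.2.1
  by_cases hij : i = j
  · simpa [blockExtend, hij] using hp
  · by_cases hi : i.val < k <;> by_cases hj : j.val < k <;>
      simp [blockExtend, bisection, hij, hi, hj, hqp]

/-- The eigenvalue estimates for the signed stochastic bisection model, with explicit errors. -/
theorem one_sub_le_measureReal_eigval_block {k : ℕ} (hk : 2 ≤ k) {p q s : unitInterval}
    (hqp : (q : ℝ) ≤ p) (hs : (s : ℝ) ≤ 1 / 2) {R r : ℝ} {j : ℕ} (hR : 1 ≤ R)
    (hRk : R ^ 2 = k * ((p : ℝ) + q)) (hr : ((2 ^ (j + 1) : ℕ) + 1 : ℝ) ^ 2 ≤ r)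
    (hrk : (p : ℝ) * (2 * k : ℕ) = r ^ 2)
    {Ω : Type*} [MeasurableSpace Ω] {μ : Measure Ω} [IsProbabilityMeasure μ]
    {A : Ω → Matrix (Fin (2 * k)) (Fin (2 * k)) ℝ} (hA : HasLaw A (signedBlock k p q s) μ) :
    1 - (2 * (2 * k / 2 ^ 2 ^ (j + 1)) + 2 * k * Real.exp (-(R ^ 2 / 8))) ≤
      μ.real {ω |
        |eigval (normalizedSignedLaplacian (A ω)) 1 - 2 * (s : ℝ)| ≤ 688 / R ∧
        |eigval (normalizedSignedLaplacian (A ω)) 2 -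
          (1 - (1 - 2 * (s : ℝ)) * (((p : ℝ) - q) / ((p : ℝ) + q)))| ≤ 688 / R ∧
        ∀ l : ℕ, 2 < l → l ≤ 2 * k →
          |eigval (normalizedSignedLaplacian (A ω)) l - 1| ≤ 688 / R} := by
  have hp0 := p.2.1
  have hq0 := q.2.1
  have hk2 : (2 : ℝ) ≤ k := by exact_mod_cast hk
  have hr0 : 0 ≤ r := le_trans (by positivity) hr
  have b1 := measureReal_adjacency_tail_le (S := blockProb k s (unitInterval.symm s))
    (blockProb_le (k := k) hqp) hp0 p.2.2 (by omega) hr hrk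
  have b2 := measureReal_abs_adjacency_tail_le (S := blockProb k s (unitInterval.symm s))
    (blockProb_le (k := k) hqp) hp0 p.2.2 (by omega) hr hrk
  -- The expected degree R² - p is at least R²/2 because k ≥ 2.
  have b3 := measureReal_nodeDegree_lt_le (P := blockProb k p q)
    (S := blockProb k s (unitInterval.symm s)) (t := R ^ 2 / 8) (fun i => by
      rw [sum_meanAbsAdjacency_block, hRk]; nlinarith)
  refine le_trans (le_of_eq ?_) (one_sub_add_le_measureReal_of_hasLaw hA b1 b2 b3
    (Q := fun M => |eigval (normalizedSignedLaplacian M) 1 - 2 * (s : ℝ)| ≤ 688 / R ∧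
        |eigval (normalizedSignedLaplacian M) 2 -
          (1 - (1 - 2 * (s : ℝ)) * (((p : ℝ) - q) / ((p : ℝ) + q)))| ≤ 688 / R ∧
        ∀ l : ℕ, 2 < l → l ≤ 2 * k →
          |eigval (normalizedSignedLaplacian M) l - 1| ≤ 688 / R)
    fun x hx₁ hx₂ hx₃ => ?_)
  · push_cast
    ring
  · refine eigval_block_of_concentration (by omega) hqp hs hR hRk (θ := 12 * r) (by positivity) ?_
      hx₃ hx₁ hx₂
    -- θ² = 144 · 2kp = 288kp ≤ 288R².
    rw [mul_pow, ← hrk, hRk]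
    push_cast
    nlinarith

theorem corollary4p5 (γ₁ γ₂ : ℝ) (hγ₂ : 0 < γ₂) (hγ : γ₂ < γ₁)
    (s : unitInterval) (hs₀ : 0 < (s : ℝ)) (hs : (s : ℝ) < 1 / 2) :
    ∃ C : ℝ, 0 < C ∧ ∃ K : ℕ, ∀ k : ℕ, 2 ≤ k → K ≤ k →
      ∀ p q : unitInterval,
        (p : ℝ) = γ₁ * (k : ℝ) ^ (-(1 / 2) : ℝ) →
        (q : ℝ) = γ₂ * (k : ℝ) ^ (-(1 / 2) : ℝ) →
      ∀ {Ω : Type*} [MeasurableSpace Ω] (μ : Measure Ω) [IsProbabilityMeasure μ]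
        (A : Ω → Matrix (Fin (2 * k)) (Fin (2 * k)) ℝ),
        HasLaw A (signedBlock k p q s) μ →
        1 - (k : ℝ) ^ (-2 : ℝ) ≤
          μ.real {ω |
            |eigval (normalizedSignedLaplacian (A ω)) 1 - 2 * (s : ℝ)|
                ≤ C * (k : ℝ) ^ (-(1 / 4) : ℝ) ∧
            |eigval (normalizedSignedLaplacian (A ω)) 2 -
                  (1 - (1 - 2 * (s : ℝ)) * ((γ₁ - γ₂) / (γ₁ + γ₂)))|
                ≤ C * (k : ℝ) ^ (-(1 / 4) : ℝ) ∧
            ∀ l : ℕ, 2 < l → l ≤ 2 * k →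
              |eigval (normalizedSignedLaplacian (A ω)) l - 1|
                ≤ C * (k : ℝ) ^ (-(1 / 4) : ℝ)} := by
  have hγ₁ : 0 < γ₁ := hγ₂.trans hγ
  have hγs : 0 < γ₁ + γ₂ := by linarith
  -- Squared, this gives (L+1)² ≤ r with r = √(2γ₁) k^(1/4). The next bound, 3 log k + 2 ≤ R²/8,
  -- yields both R ≥ 1 and the tail bound for the degrees.
  have ev1 := eventually_log_le_rpow 12 13 (c := √√(2 * γ₁)) (s := 1 / 8) (by positivity)
    (by norm_num)
  have ev2 := eventually_log_le_rpow 3 2 (c := (γ₁ + γ₂) / 8) (s := 1 / 2) (by positivity)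
    (by norm_num)
  obtain ⟨K, hK⟩ := Filter.eventually_atTop.1 (ev1.and ev2)
  refine ⟨688 / √(γ₁ + γ₂), by positivity, K, fun k hk hKk p q hp hq Ω _ μ _ A hA => ?_⟩
  obtain ⟨h1, h2⟩ := hK k hKk
  have hk2 : (2 : ℝ) ≤ k := by exact_mod_cast hk
  have hk0 : (0 : ℝ) < k := by linarith
  have hlog : 0 ≤ Real.log k := Real.log_nonneg (by linarith)
  set t : ℝ := (k : ℝ) ^ (1 / 4 : ℝ) with ht
  have ht0 : 0 < t := Real.rpow_pos_of_pos hk0 _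
  have ht8 : ((k : ℝ) ^ (1 / 8 : ℝ)) ^ 2 = t := by
    rw [ht, ← Real.rpow_natCast, ← Real.rpow_mul hk0.le]; norm_num
  have ht2 : (k : ℝ) ^ (1 / 2 : ℝ) = t ^ 2 := by
    rw [ht, ← Real.rpow_natCast, ← Real.rpow_mul hk0.le]; norm_num
  have ht4 : (k : ℝ) = t ^ 4 := by
    rw [ht, ← Real.rpow_natCast, ← Real.rpow_mul hk0.le]; norm_num
  rw [Real.rpow_neg hk0.le, ht2] at hp hq
  rw [Real.rpow_neg hk0.le (1 / 4), ← ht]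
  set R := √(γ₁ + γ₂) * t with hRdef
  have hR0 : 0 < R := by positivity
  have hR2 : R ^ 2 = (γ₁ + γ₂) * t ^ 2 := by rw [hRdef, mul_pow, Real.sq_sqrt hγs.le]
  rw [ht2] at h2
  have hR : 1 ≤ R := by
    by_contra hlt
    have : R ^ 2 ≤ 1 := pow_le_one₀ hR0.le (not_le.1 hlt).le
    linarith
  obtain ⟨j, hj1, hj2⟩ := exists_two_pow_two_pow_ge (k := k) (by omega)
  have hr : ((2 ^ (j + 1) : ℕ) + 1 : ℝ) ^ 2 ≤ √(2 * γ₁) * t := by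
    calc _ ≤ (√√(2 * γ₁) * (k : ℝ) ^ (1 / 8 : ℝ)) ^ 2 := by
          refine pow_le_pow_left₀ (by positivity) (hj2.trans h1) 2
      _ = _ := by rw [mul_pow, ht8, Real.sq_sqrt (Real.sqrt_nonneg _)]
  have hqp : (q : ℝ) ≤ p := by rw [hp, hq]; gcongr
  have hmain := one_sub_le_measureReal_eigval_block hk hqp hs.le hR
    (by rw [hR2, hp, hq, ht4]; field_simp) hr
    (by rw [mul_pow, Real.sq_sqrt (by positivity), hp]; push_cast; rw [ht4]; field_simp) hA
  have hC : 688 / √(γ₁ + γ₂) * t⁻¹ = 688 / R := by rw [hRdef]; field_simp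
  have hratio : ((p : ℝ) - q) / ((p : ℝ) + q) = (γ₁ - γ₂) / (γ₁ + γ₂) := by
    rw [hp, hq]; field_simp
  rw [hC]
  rw [hratio] at hmain
  refine le_trans (sub_le_sub_left ?_ 1) hmain
  -- Each of the two spectral events fails with probability at most 1/(4k²), and the degree event
  -- with probability at most 1/(2k²).
  have e1 : (2 * k / 2 ^ 2 ^ (j + 1) : ℝ) ≤ 1 / (4 * k ^ 2) := by
    rw [div_le_div_iff₀ (by positivity) (by positivity)]
    linarith
  have e2 : Real.exp (-(R ^ 2 / 8)) ≤ 1 / (4 * k ^ 3) := by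
    rw [Real.exp_neg, ← one_div]
    refine one_div_le_one_div_of_le (by positivity) ?_
    have h3 : Real.exp (3 * Real.log k + 2) = k ^ 3 * (Real.exp 1 * Real.exp 1) := by
      rw [Real.exp_add, ← Real.exp_add 1 1, ← Nat.cast_ofNat (n := 3), ← Real.log_pow,
        Real.exp_log (by positivity)]
      norm_num
    have h4 : 2 ≤ Real.exp 1 := by have := Real.exp_one_gt_d9; linarith
    calc 4 * (k : ℝ) ^ 3 = k ^ 3 * (2 * 2) := by ring
      _ ≤ k ^ 3 * (Real.exp 1 * Real.exp 1) := by gcongr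
      _ = Real.exp (3 * Real.log k + 2) := h3.symm
      _ ≤ Real.exp (R ^ 2 / 8) := Real.exp_le_exp.2 (by rw [hR2]; linarith)
  have e3 : (k : ℝ) ^ (-2 : ℝ) = 1 / k ^ 2 := by
    rw [Real.rpow_neg hk0.le, one_div]; norm_num
  rw [e3]
  calc 2 * (2 * k / 2 ^ 2 ^ (j + 1)) + 2 * k * Real.exp (-(R ^ 2 / 8))
      ≤ 2 * (1 / (4 * k ^ 2)) + 2 * k * (1 / (4 * k ^ 3)) := by gcongr
    _ = 1 / (k : ℝ) ^ 2 := by field_simp; norm_num
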